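/- For $r\in\mathbb R$ let $T_r=e^{ir\partial_x^2}$ be the free Schrödinger evolution on $L^2(\mathbb R)$, i.e. the Fourier multiplier $\widehat{T_rf}(k)=e^{-irk^2}\hat f(k)$, where $\hat f(k)=(2\pi)^{-1/2}\int_{\mathbb R}e^{-ikx}f(x)\,dx$ (extended to $L^2$ by continuity). For a measure $\mu(dr)=\psi(r)\,dr$ with a (possibly signed or complex) density $\psi$, put $$Q^c_\mu(f_1,f_2,f_3,f_4)=\int_{\mathbb R}\int_{\mathbb R}\overline{(T_rf_1)(x)}\,(T_rf_2)(x)\,\overline{(T_rf_3)(x)}\,(T_rf_4)(x)\,dx\,\mu(dr).$$ Let $f_1,f_2,f_3,f_4\in L^2(\mathbb R)$, let $\operatorname{supp}$ denote the (essential) support, let $\|\cdot\|$ be the $L^2(\mathbb R)$ norm, and let the distance of two sets be $\infty$ if one of them is empty. 1. Suppose $\psi\in L^4(\mathbb R,dt)$. If $\operatorname{dist}(\operatorname{supp}\hat f_i,\operatorname{supp}\hat f_j)\ge s>0$ for some $i\ne j$, then the integral defining $Q^c_\mu(f_1,f_2,f_3,f_4)$ converges absolutely and $$|Q^c_\mu(f_1,f_2,f_3,f_4)|\le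 \frac{C}{\sqrt s}\,\|f_1\|\,\|f_2\|\,\|f_3\|\,\|f_4\|,$$ where $C$ depends only on $\|\psi\|_{L^4(\mathbb R,dt)}$. 2. Suppose $\psi\in L^4(\mathbb R,t^2dt)$. If $\operatorname{dist}(\operatorname{supp} f_i,\operatorname{supp} f_j)\ge s>0$ for some $i\ne j$, then the integral defining $Q^c_\mu(f_1,f_2,f_3,f_4)$ converges absolutely and the same bound holds, where $C$ depends only on $\|\psi\|_{L^4(\mathbb R,t^2dt)}$. -/

import Mathlib

open MeasureTheory FourierTransform Topology
open scoped ENNReal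

noncomputable section

namespace DispersionManagement

/-- The Hilbert space `L²(ℝ)` of complex-valued functions. -/
abbrev L2R : Type := Lp ℂ 2 (volume : Measure ℝ)

/-- The symbol of `e^{ir∂ₓ²}` at frequency `ξ`: the angular frequency is `k = 2πξ` in Mathlib's
normalisation of the Fourier transform, and the symbol is `e^{-irk²}`. -/
def schrodingerSymbol (r ξ : ℝ) : ℂ :=
  Complex.exp (-(Complex.I * (r * (2 * Real.pi * ξ) ^ 2 : ℝ)))

theorem norm_schrodingerSymbol (r ξ : ℝ) : ‖schrodingerSymbol r ξ‖ = 1 := by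
  unfold schrodingerSymbol
  rw [Complex.norm_exp]
  simp [-Complex.ofReal_mul, -Complex.ofReal_pow]

theorem continuous_schrodingerSymbol (r : ℝ) : Continuous (schrodingerSymbol r) := by
  unfold schrodingerSymbol
  fun_prop

theorem memLp_schrodingerSymbol_mul (r : ℝ) (g : L2R) :
    MemLp (fun ξ => schrodingerSymbol r ξ * g ξ) 2 (volume : Measure ℝ) := by
  refine (Lp.memLp g).of_le
    ((continuous_schrodingerSymbol r).aestronglyMeasurable.mul (Lp.aestronglyMeasurable g)) ?_
  filter_upwards with ξ
  rw [norm_mul, norm_schrodingerSymbol, one_mul]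

/-- The free Schrödinger evolution `T_r = e^{ir∂ₓ²}` on `L²(ℝ)`, defined as the Fourier multiplier
with symbol `e^{-irk²}`. -/
def freeEvolution (r : ℝ) (f : L2R) : L2R :=
  𝓕⁻ ((memLp_schrodingerSymbol_mul r (𝓕 f)).toLp _ : L2R)

/-- The integrand `x ↦ conj(T_r f₁(x)) · T_r f₂(x) · conj(T_r f₃(x)) · T_r f₄(x)`
(the four functions are indexed by `0, 1, 2, 3`). -/
def quarticIntegrand (f : Fin 4 → L2R) (r x : ℝ) : ℂ :=
  starRingEnd ℂ (freeEvolution r (f 0) x) * freeEvolution r (f 1) x *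
    starRingEnd ℂ (freeEvolution r (f 2) x) * freeEvolution r (f 3) x

/-- The four-linear functional `Q_μ(f₁, f₂, f₃, f₄)` for the measure `μ(dr) = ψ(r) dr`. The density
may be real or complex valued, so `μ` need not be positive. -/
def calQ (ψ : ℝ → ℂ) (f : Fin 4 → L2R) : ℂ :=
  ∫ r, (∫ x, quarticIntegrand f r x) * ψ r

/-- The iterated integral defining `calQ ψ f` converges absolutely. -/
structure CalQConverges (ψ : ℝ → ℂ) (f : Fin 4 → L2R) : Prop where
  inner : ∀ᵐ r : ℝ, Integrable (quarticIntegrand f r)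
  outer : Integrable (fun r : ℝ => (∫ x, quarticIntegrand f r x) * ψ r)
  absolute : Integrable (fun r : ℝ => (∫ x, ‖quarticIntegrand f r x‖) * ‖ψ r‖)

/-- For a positive measure `μ` with density `ψ ≥ 0`, `calQ` is the iterated integral
against `dx μ(dr)`. -/
theorem calQ_eq_integral_measure (ψ : ℝ → ℝ) (hψ : AEMeasurable ψ) (hψ0 : ∀ r, 0 ≤ ψ r)
    (μ : Measure ℝ) (hμ : μ = volume.withDensity (fun r => ENNReal.ofReal (ψ r)))
    (f : Fin 4 → L2R) :
    calQ (fun r => (ψ r : ℂ)) f = ∫ r, ∫ x, quarticIntegrand f r x ∂volume ∂μ := by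
  rw [hμ, integral_withDensity_eq_integral_toReal_smul₀ hψ.ennreal_ofReal
    (Filter.Eventually.of_forall fun _ => ENNReal.ofReal_lt_top)]
  unfold calQ
  congr 1
  funext r
  rw [ENNReal.toReal_ofReal (hψ0 r), Complex.real_smul, mul_comm]

/-- The support of an (equivalence class of a) function on `ℝ`: the complement of the largest open
set on which it vanishes almost everywhere. -/
def essSupport (g : ℝ → ℂ) : Set ℝ :=
  {x | ∀ U ∈ 𝓝 x, ¬ (∀ᵐ y ∂(volume.restrict U), g y = 0)}

/-- The unitary Fourier transform in the normalisation
`f̂(k) = (2π)^{-1/2} ∫ e^{-ikx} f(x) dx`, extended to `L²(ℝ)`. -/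
def unitaryFourier (f : L2R) (k : ℝ) : ℂ :=
  ((Real.sqrt (2 * Real.pi))⁻¹ : ℝ) * (𝓕 f : L2R) (k / (2 * Real.pi))

/-- The distance `inf {|x - y| : x ∈ A, y ∈ B}` of two sets, equal to `∞` if one is empty. -/
def setDist (A B : Set ℝ) : ℝ≥0∞ := ⨅ x ∈ A, ⨅ y ∈ B, edist x y

/-- The measure `t² dt` on `ℝ`. -/
def sqMeasure : Measure ℝ := volume.withDensity (fun t => ENNReal.ofReal (t ^ 2))

end DispersionManagement

end

noncomputable section

namespace DispersionManagement

theorem fourier_toLp_ae_eq {g : ℝ → ℂ} (h1 : Integrable g) (h2 : MemLp g 2 volume) :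
    ((𝓕 (h2.toLp g) : L2R) : ℝ → ℂ) =ᵐ[volume] 𝓕 g := by
  have hcont : Continuous (𝓕 g) :=
    VectorFourier.fourierIntegral_continuous Real.continuous_fourierChar
      (by exact continuous_inner) h1
  refine ae_eq_of_integral_contDiff_smul_eq
    ((Lp.memLp _).locallyIntegrable (by norm_num)) hcont.locallyIntegrable ?_
  intro φ hφ hφc
  have hφ' : ContDiff ℝ (⊤ : ℕ∞) (fun x => (φ x : ℂ)) := Complex.ofRealCLM.contDiff.comp hφ
  have hφc' : HasCompactSupport (fun x => (φ x : ℂ)) := hφc.comp_left (g := Complex.ofReal) rfl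
  let Φ : SchwartzMap ℝ ℂ := hφc'.toSchwartzMap hφ'
  have hΦ : ∀ x, Φ x = φ x := fun x => rfl
  have key := congrArg (fun T => T Φ) (Lp.fourier_toTemperedDistribution_eq (h2.toLp g))
  simp only [TemperedDistribution.fourier_apply, Lp.toTemperedDistribution_apply] at key
  have e1 : ∫ x, (𝓕 Φ : SchwartzMap ℝ ℂ) x • (h2.toLp g : L2R) x = ∫ x, (𝓕 Φ : SchwartzMap ℝ ℂ) x • g x :=
    integral_congr_ae (by filter_upwards [h2.coeFn_toLp] with x hx; rw [hx])
  have e2 : ∫ x, (𝓕 Φ : SchwartzMap ℝ ℂ) x • g x = ∫ x, Φ x • 𝓕 g x := by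
    have := VectorFourier.integral_fourierIntegral_smul_eq_flip (L := innerₗ ℝ) (μ := volume)
      (ν := volume) (e := 𝐞) Real.continuous_fourierChar (by exact continuous_inner)
      (f := Φ) (g := g) Φ.integrable h1
    simpa using! this
  have e3 := e1.trans e2
  rw [key] at e3
  simpa [hΦ] using e3

theorem lintegral_enorm_fourier_sq {g : ℝ → ℂ} (h1 : Integrable g) (h2 : MemLp g 2 volume) :
    ∫⁻ x, ‖𝓕 g x‖ₑ ^ 2 = ∫⁻ x, ‖g x‖ₑ ^ 2 := by
  have h : eLpNorm (𝓕 g) 2 volume = eLpNorm g 2 volume := by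
    rw [← eLpNorm_congr_ae (fourier_toLp_ae_eq h1 h2), ← eLpNorm_congr_ae h2.coeFn_toLp,
      ← Lp.enorm_def, ← Lp.enorm_def, ← ofReal_norm, Lp.norm_fourier_eq, ofReal_norm]
  rw [eLpNorm_eq_lintegral_rpow_enorm_toReal (by norm_num) (by norm_num),
    eLpNorm_eq_lintegral_rpow_enorm_toReal (by norm_num) (by norm_num)] at h
  have := congrArg (fun y : ℝ≥0∞ => y ^ (2 : ℝ)) h
  simp only [← ENNReal.rpow_mul, ENNReal.toReal_ofNat] at this
  simpa using this

theorem fourierInv_eq_fourier_comp_neg_apply (g : ℝ → ℂ) (x : ℝ) : 𝓕⁻ g x = 𝓕 g (-x) := by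
  simpa using! Real.fourierInv_eq_fourier_neg g x

theorem lintegral_enorm_fourierInv_sq {g : ℝ → ℂ} (h1 : Integrable g) (h2 : MemLp g 2 volume) :
    ∫⁻ x, ‖𝓕⁻ g x‖ₑ ^ 2 = ∫⁻ x, ‖g x‖ₑ ^ 2 := by
  rw [← lintegral_enorm_fourier_sq h1 h2,
    ← lintegral_neg_eq_self (fun x => ‖𝓕 g x‖ₑ ^ 2)]
  simp_rw [fourierInv_eq_fourier_comp_neg_apply]

theorem fourierInv_toLp_ae_eq {g : ℝ → ℂ} (h1 : Integrable g) (h2 : MemLp g 2 volume) :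
    ((𝓕⁻ (h2.toLp g) : L2R) : ℝ → ℂ) =ᵐ[volume] 𝓕⁻ g := by
  have hcont : Continuous (𝓕⁻ g) := by
    have : Continuous (𝓕 g) := VectorFourier.fourierIntegral_continuous Real.continuous_fourierChar
      (by exact continuous_inner) h1
    have e : 𝓕⁻ g = fun x => 𝓕 g (-x) := funext (fourierInv_eq_fourier_comp_neg_apply g)
    rw [e]; fun_prop
  refine ae_eq_of_integral_contDiff_smul_eq
    ((Lp.memLp _).locallyIntegrable (by norm_num)) hcont.locallyIntegrable ?_
  intro φ hφ hφc
  have hφ' : ContDiff ℝ (⊤ : ℕ∞) (fun x => (φ x : ℂ)) := Complex.ofRealCLM.contDiff.comp hφ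
  have hφc' : HasCompactSupport (fun x => (φ x : ℂ)) := hφc.comp_left (g := Complex.ofReal) rfl
  let Φ : SchwartzMap ℝ ℂ := hφc'.toSchwartzMap hφ'
  have hΦ : ∀ x, Φ x = φ x := fun x => rfl
  have key := congrArg (fun T => T Φ) (Lp.fourierInv_toTemperedDistribution_eq (h2.toLp g))
  simp only [TemperedDistribution.fourierInv_apply, Lp.toTemperedDistribution_apply] at key
  have e1 : ∫ x, (𝓕⁻ Φ : SchwartzMap ℝ ℂ) x • (h2.toLp g : L2R) x = ∫ x, (𝓕⁻ Φ : SchwartzMap ℝ ℂ) x • g x :=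
    integral_congr_ae (by filter_upwards [h2.coeFn_toLp] with x hx; rw [hx])
  have e2 : ∫ x, (𝓕⁻ Φ : SchwartzMap ℝ ℂ) x • g x = ∫ x, Φ x • 𝓕⁻ g x := by
    have := VectorFourier.integral_fourierIntegral_smul_eq_flip (L := innerₗ ℝ) (μ := volume)
      (ν := volume) (e := 𝐞) Real.continuous_fourierChar (by exact continuous_inner)
      (f := Φ) (g := fun x => g (-x)) Φ.integrable h1.comp_neg
    have h3 : ∀ x, 𝓕⁻ g x = 𝓕 (fun y => g (-y)) x := fun x => by
      rw [Real.fourierInv_eq_fourier_comp_neg]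
    simp_rw [h3]
    rw [← integral_neg_eq_self (fun x => (𝓕⁻ Φ : SchwartzMap ℝ ℂ) x • g x) volume]
    have h4 : ∀ x, (𝓕⁻ Φ : SchwartzMap ℝ ℂ) (-x) = (𝓕 Φ : SchwartzMap ℝ ℂ) x := fun x => by
      rw [SchwartzMap.fourierInv_coe, fourierInv_eq_fourier_comp_neg_apply, neg_neg,
        SchwartzMap.fourier_coe]
    simp_rw [h4]
    simpa using! this
  have e3 := e1.trans e2
  rw [key] at e3
  simpa [hΦ] using e3

theorem lintegral_comp_mul_left {a : ℝ} (ha : a ≠ 0) (f : ℝ → ℝ≥0∞) :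
    ∫⁻ x, f (a * x) = ENNReal.ofReal |a⁻¹| * ∫⁻ x, f x := by
  have h := lintegral_map_equiv f (Homeomorph.mulLeft₀ a ha).toMeasurableEquiv (μ := volume)
  have h2 : Measure.map (Homeomorph.mulLeft₀ a ha).toMeasurableEquiv volume
      = ENNReal.ofReal |a⁻¹| • (volume : Measure ℝ) := Real.map_volume_mul_left ha
  rw [h2, lintegral_smul_measure] at h
  exact h.symm

/-- Measurable, integrable and bounded functions. -/
structure BddInt (g : ℝ → ℂ) : Prop where
  meas : Measurable g
  int : Integrable g
  bdd : ∃ M : ℝ, ∀ x, ‖g x‖ ≤ M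

namespace BddInt

variable {g h : ℝ → ℂ}

theorem memLp_two (hg : BddInt g) : MemLp g 2 volume := by
  obtain ⟨M, hM⟩ := hg.bdd
  rw [memLp_two_iff_integrable_sq_norm hg.meas.aestronglyMeasurable]
  simp_rw [pow_two]
  exact hg.int.norm.bdd_mul hg.meas.norm.aestronglyMeasurable
    (Filter.Eventually.of_forall fun x => by simpa using hM x)

theorem of_norm_le (hg : BddInt g) (hm : Measurable h) (hle : ∀ x, ‖h x‖ ≤ ‖g x‖) : BddInt h :=
  ⟨hm, hg.int.mono hm.aestronglyMeasurable (Filter.Eventually.of_forall hle),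
    hg.bdd.imp fun _ hM x => (hle x).trans (hM x)⟩

theorem convolution (hg : BddInt g) (hh : BddInt h) :
    BddInt (MeasureTheory.convolution g h (ContinuousLinearMap.mul ℂ ℂ) volume) := by
  refine ⟨?_, hg.int.integrable_convolution _ hh.int, ?_⟩
  · refine StronglyMeasurable.measurable ?_
    refine StronglyMeasurable.integral_prod_right
      (f := fun x t => (ContinuousLinearMap.mul ℂ ℂ) (g t) (h (x - t))) ?_
    have := hg.meas
    have := hh.meas
    simp only [ContinuousLinearMap.mul_apply']
    refine Measurable.stronglyMeasurable ?_
    fun_prop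
  · obtain ⟨M, hM⟩ := hh.bdd
    refine ⟨∫ t, ‖g t‖ * M, fun x => ?_⟩
    refine norm_integral_le_of_norm_le (hg.int.norm.mul_const M)
      (Filter.Eventually.of_forall fun t => ?_)
    simp only [ContinuousLinearMap.mul_apply', norm_mul]
    gcongr
    exact hM _

theorem lintegral_fourierInv (hg : BddInt g) :
    ∫⁻ x, ‖𝓕⁻ g x‖ₑ ^ 2 = ∫⁻ x, ‖g x‖ₑ ^ 2 :=
  lintegral_enorm_fourierInv_sq hg.int hg.memLp_two

theorem lintegral_fourier (hg : BddInt g) :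
    ∫⁻ x, ‖𝓕 g x‖ₑ ^ 2 = ∫⁻ x, ‖g x‖ₑ ^ 2 :=
  lintegral_enorm_fourier_sq hg.int hg.memLp_two

theorem symbol_mul (hg : BddInt g) (r : ℝ) : BddInt (fun ξ => schrodingerSymbol r ξ * g ξ) :=
  hg.of_norm_le ((continuous_schrodingerSymbol r).measurable.mul hg.meas)
    fun x => by rw [norm_mul, norm_schrodingerSymbol, one_mul]

end BddInt

theorem fourierInv_mul_convolution {a b : ℝ → ℂ} (ha : Integrable a) (hb : Integrable b) (x : ℝ) :
    𝓕⁻ (convolution a b (ContinuousLinearMap.mul ℂ ℂ) volume) x = 𝓕⁻ a x * 𝓕⁻ b x := by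
  simp_rw [fourierInv_eq_fourier_comp_neg_apply]
  exact Real.fourier_mul_convolution_eq ha hb _

theorem fourierInv_conj_comp_neg (b : ℝ → ℂ) (x : ℝ) :
    𝓕⁻ (fun t => starRingEnd ℂ (b (-t))) x = starRingEnd ℂ (𝓕⁻ b x) := by
  rw [Real.fourierInv_eq', Real.fourierInv_eq', ← integral_conj,
    ← integral_neg_eq_self (fun v => starRingEnd ℂ _)]
  congr 1
  funext v
  simp [← Complex.exp_conj, Complex.conj_ofNat]

/-- The solution of the free Schrödinger equation whose initial datum has Fourier transform `g`. -/
def evol (g : ℝ → ℂ) (r x : ℝ) : ℂ := 𝓕⁻ (fun ξ => schrodingerSymbol r ξ * g ξ) x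

theorem measurable_evol {g : ℝ → ℂ} (hg : Measurable g) :
    Measurable (fun p : ℝ × ℝ => evol g p.1 p.2) := by
  unfold evol
  simp_rw [Real.fourierInv_eq']
  refine StronglyMeasurable.measurable ?_
  refine StronglyMeasurable.integral_prod_right ?_
  unfold schrodingerSymbol
  refine Measurable.stronglyMeasurable ?_
  simp only [RCLike.inner_apply, conj_trivial, smul_eq_mul]
  fun_prop

section

variable {g h : ℝ → ℂ}

theorem symbol_mul_conj_symbol (r t K : ℝ) :
    schrodingerSymbol r t * starRingEnd ℂ (schrodingerSymbol r (t - K)) =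
      Complex.exp ((4 * Real.pi ^ 2 * r * K ^ 2 : ℝ) * Complex.I) *
        Complex.exp (((-2 * Real.pi * t * (4 * Real.pi * K * r) : ℝ)) * Complex.I) := by
  unfold schrodingerSymbol
  rw [← Complex.exp_conj, ← Complex.exp_add, ← Complex.exp_add]
  congr 1
  simp only [map_neg, map_mul, Complex.conj_I, Complex.conj_ofReal]
  push_cast
  ring

theorem lintegral_evol_mul_evol_space (hg : BddInt g) (hh : BddInt h) (r : ℝ) :
    ∫⁻ x, ‖evol g r x‖ₑ ^ 2 * ‖evol h r x‖ₑ ^ 2 =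
      ∫⁻ K, ‖𝓕 (fun t => g t * starRingEnd ℂ (h (t - K))) (4 * Real.pi * K * r)‖ₑ ^ 2 := by
  set a : ℝ → ℂ := fun ξ => schrodingerSymbol r ξ * g ξ with ha
  set b : ℝ → ℂ := fun ξ => schrodingerSymbol r ξ * h ξ with hb
  have hA : BddInt a := hg.symbol_mul r
  have hB : BddInt b := hh.symbol_mul r
  have hB' : BddInt (fun t => starRingEnd ℂ (b (-t))) := by
    refine ⟨?_, ?_, ?_⟩
    · have := hB.meas
      exact Complex.continuous_conj.measurable.comp (this.comp measurable_neg)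
    · exact (LinearIsometryEquiv.integrable_comp_iff Complex.conjLIE).2 hB.int.comp_neg
    · obtain ⟨M, hM⟩ := hB.bdd
      exact ⟨M, fun x => by simpa using hM (-x)⟩
  have e : ∀ x, ‖evol g r x‖ₑ ^ 2 * ‖evol h r x‖ₑ ^ 2 =
      ‖𝓕⁻ (convolution a (fun t => starRingEnd ℂ (b (-t))) (ContinuousLinearMap.mul ℂ ℂ) volume)
        x‖ₑ ^ 2 := fun x => by
    rw [fourierInv_mul_convolution hA.int hB'.int, fourierInv_conj_comp_neg, enorm_mul, mul_pow,
      RCLike.enorm_conj]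
    rfl
  simp_rw [e]
  rw [(hA.convolution hB').lintegral_fourierInv]
  congr 1
  funext K
  congr 1
  unfold convolution
  have e2 : ∀ t, (ContinuousLinearMap.mul ℂ ℂ) (a t) (starRingEnd ℂ (b (-(K - t)))) =
      Complex.exp ((4 * Real.pi ^ 2 * r * K ^ 2 : ℝ) * Complex.I) *
        (Complex.exp (((-2 * Real.pi * t * (4 * Real.pi * K * r) : ℝ)) * Complex.I) •
          (g t * starRingEnd ℂ (h (t - K)))) := fun t => by
    rw [← smul_eq_mul, smul_eq_mul, smul_eq_mul, ← mul_assoc, ← symbol_mul_conj_symbol]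
    simp only [ha, hb, ContinuousLinearMap.mul_apply', map_mul, neg_sub]
    ring
  simp_rw [e2]
  rw [integral_const_mul, enorm_mul, ← Real.fourier_real_eq_integral_exp_smul,
    ← ofReal_norm (Complex.exp _), Complex.norm_exp_ofReal_mul_I, ENNReal.ofReal_one, one_mul]

theorem BddInt.mul_conj_shift (hg : BddInt g) (hh : BddInt h) (K : ℝ) :
    BddInt (fun t => g t * starRingEnd ℂ (h (t - K))) := by
  have hm : Measurable (fun t => starRingEnd ℂ (h (t - K))) :=
    Complex.continuous_conj.measurable.comp (hh.meas.comp (measurable_sub_const K))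
  obtain ⟨M, hM⟩ := hg.bdd
  obtain ⟨N, hN⟩ := hh.bdd
  refine ⟨hg.meas.mul hm, ?_, M * N, fun x => ?_⟩
  · exact hg.int.mul_bdd (c := N) hm.aestronglyMeasurable
      (Filter.Eventually.of_forall fun x => by simpa using hN _)
  · rw [norm_mul, RCLike.norm_conj]
    exact mul_le_mul (hM _) (hN _) (norm_nonneg _) ((norm_nonneg _).trans (hM x))

theorem lintegral_evol_mul_evol (hg : BddInt g) (hh : BddInt h) :
    ∫⁻ r, ∫⁻ x, ‖evol g r x‖ₑ ^ 2 * ‖evol h r x‖ₑ ^ 2 =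
      ∫⁻ K, ENNReal.ofReal |(4 * Real.pi * K)⁻¹| * ∫⁻ t, ‖g t‖ₑ ^ 2 * ‖h (t - K)‖ₑ ^ 2 := by
  simp_rw [lintegral_evol_mul_evol_space hg hh]
  have hgm := hg.meas
  have hhm := hh.meas
  rw [lintegral_lintegral_swap]
  · refine lintegral_congr_ae ?_
    filter_upwards [Measure.ae_ne volume (0 : ℝ)] with K hK
    have hK' : 4 * Real.pi * K ≠ 0 := by positivity
    rw [lintegral_comp_mul_left hK'
      (fun y => ‖𝓕 (fun t => g t * starRingEnd ℂ (h (t - K))) y‖ₑ ^ 2),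
      (hg.mul_conj_shift hh K).lintegral_fourier]
    simp_rw [enorm_mul, mul_pow, RCLike.enorm_conj]
  · refine Measurable.aemeasurable ?_
    refine (Measurable.enorm ?_).pow_const 2
    simp only [Real.fourier_real_eq_integral_exp_smul]
    refine StronglyMeasurable.measurable ?_
    refine StronglyMeasurable.integral_prod_right ?_
    refine Measurable.stronglyMeasurable ?_
    have : Measurable (fun z : ℂ => starRingEnd ℂ z) := Complex.continuous_conj.measurable
    simp only [smul_eq_mul]
    fun_prop

/-- Bilinear refinement of the Strichartz estimate for separated frequencies. -/
theorem lintegral_evol_mul_evol_le (hg : BddInt g) (hh : BddInt h) {δ : ℝ} (hδ : 0 < δ)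
    (hsep : ∀ ξ η, g ξ ≠ 0 → h η ≠ 0 → δ ≤ |ξ - η|) :
    ∫⁻ r, ∫⁻ x, ‖evol g r x‖ₑ ^ 2 * ‖evol h r x‖ₑ ^ 2 ≤
      ENNReal.ofReal (1 / δ) * ((∫⁻ t, ‖g t‖ₑ ^ 2) * ∫⁻ t, ‖h t‖ₑ ^ 2) := by
  have hgm := hg.meas
  have hhm := hh.meas
  rw [lintegral_evol_mul_evol hg hh]
  calc _ ≤ ∫⁻ K, ENNReal.ofReal (1 / δ) * ∫⁻ t, ‖g t‖ₑ ^ 2 * ‖h (t - K)‖ₑ ^ 2 := by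
        refine lintegral_mono fun K => ?_
        by_cases hK : δ ≤ |K|
        · gcongr
          rw [abs_inv, ← one_div]
          refine one_div_le_one_div_of_le hδ (hK.trans ?_)
          rw [abs_mul, abs_of_pos (by positivity : 0 < 4 * Real.pi)]
          nlinarith [Real.pi_gt_three, abs_nonneg K]
        · have : ∀ t, ‖g t‖ₑ ^ 2 * ‖h (t - K)‖ₑ ^ 2 = 0 := fun t => by
            by_contra hne
            refine hK ?_
            have := hsep t (t - K) (fun h0 => hne (by simp [h0])) (fun h0 => hne (by simp [h0]))
            simpa using this
          simp [this]
    _ = ENNReal.ofReal (1 / δ) * ∫⁻ t, ∫⁻ K, ‖g t‖ₑ ^ 2 * ‖h (t - K)‖ₑ ^ 2 := by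
        rw [lintegral_const_mul' _ _ ENNReal.ofReal_ne_top, lintegral_lintegral_swap]
        exact Measurable.aemeasurable (by fun_prop)
    _ = _ := by
        congr 1
        have : ∀ t, ∫⁻ K, ‖g t‖ₑ ^ 2 * ‖h (t - K)‖ₑ ^ 2 = ‖g t‖ₑ ^ 2 * ∫⁻ K, ‖h K‖ₑ ^ 2 :=
          fun t => by
            rw [lintegral_const_mul' _ _ (by finiteness),
              lintegral_sub_left_eq_self (fun K => ‖h K‖ₑ ^ 2) t]
        simp_rw [this]
        rw [lintegral_mul_const _ (by fun_prop)]

end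

theorem lintegral_Ioi_comp_sq (f : ℝ → ℝ≥0∞) :
    ∫⁻ ρ in Set.Ioi (0 : ℝ), f ρ = ∫⁻ r in Set.Ioi (0 : ℝ), ENNReal.ofReal (2 * r) * f (r ^ 2) := by
  have himg : (fun x : ℝ => x ^ 2) '' Set.Ioi 0 = Set.Ioi 0 := by
    ext y
    constructor
    · rintro ⟨x, hx, rfl⟩
      exact pow_pos (Set.mem_Ioi.1 hx) 2
    · intro hy
      exact ⟨√y, Real.sqrt_pos.2 hy, Real.sq_sqrt (le_of_lt hy)⟩
  have := lintegral_image_eq_lintegral_abs_deriv_mul (f := fun x : ℝ => x ^ 2)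
    (f' := fun x => 2 * x) (s := Set.Ioi 0) measurableSet_Ioi
    (fun x _ => by simpa using (hasDerivAt_pow 2 x).hasDerivWithinAt)
    (fun x hx y hy h => by
      simpa using (pow_left_inj₀ (le_of_lt hx) (le_of_lt hy) (two_ne_zero)).1 h) f
  rw [himg] at this
  rw [this]
  refine setLIntegral_congr_fun measurableSet_Ioi fun x hx => ?_
  have hx' : (0 : ℝ) < x := hx
  rw [abs_of_pos (by positivity)]

/-- Polar coordinates with the squared radius as the first coordinate. -/
def sqPolar (p : ℝ × ℝ) : ℝ × ℝ := (√p.1 * Real.cos p.2, √p.1 * Real.sin p.2)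

theorem measurable_sqPolar : Measurable sqPolar := by
  unfold sqPolar
  fun_prop

/-- The measure `dρ dθ` on `(0, ∞) × (-π, π)`. -/
def sqPolarMeasure : Measure (ℝ × ℝ) :=
  (volume.restrict (Set.Ioi 0)).prod (volume.restrict (Set.Ioo (-Real.pi) Real.pi))

theorem lintegral_sqPolar {f : ℝ × ℝ → ℝ≥0∞} (hf : Measurable f) :
    ∫⁻ p, f (sqPolar p) ∂sqPolarMeasure = 2 * ∫⁻ p, f p := by
  have hm := measurable_sqPolar
  rw [sqPolarMeasure, lintegral_prod _ (by fun_prop), lintegral_Ioi_comp_sq,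
    ← lintegral_comp_polarCoord_symm, polarCoord_target, Measure.volume_eq_prod,
    ← Measure.prod_restrict, lintegral_prod, ← lintegral_const_mul' _ _ (by finiteness)]
  · refine setLIntegral_congr_fun measurableSet_Ioi fun r hr => ?_
    have hr' : (0 : ℝ) < r := hr
    dsimp only
    rw [ENNReal.ofReal_mul (by norm_num), ENNReal.ofReal_ofNat, mul_assoc,
      ← lintegral_const_mul' _ _ (by finiteness)]
    congr 1
    refine lintegral_congr fun θ => ?_
    simp [sqPolar, Real.sqrt_sq hr'.le]
  · simp only [polarCoord_symm_apply]
    refine Measurable.aemeasurable ?_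
    simp only [smul_eq_mul]
    fun_prop

theorem measurePreserving_sqPolar :
    MeasurePreserving sqPolar sqPolarMeasure ((2 : ℝ≥0∞) • volume) := by
  refine ⟨measurable_sqPolar, Measure.ext_of_lintegral _ fun f hf => ?_⟩
  rw [lintegral_map hf measurable_sqPolar, lintegral_sqPolar hf, lintegral_smul_measure,
    smul_eq_mul]

theorem enorm_integral_sq_le_of_finite {α : Type*} [MeasurableSpace α] {μ : Measure α}
    [IsFiniteMeasure μ] {f : α → ℂ} (hf : AEStronglyMeasurable f μ) :
    ‖∫ x, f x ∂μ‖ₑ ^ 2 ≤ μ Set.univ * ∫⁻ x, ‖f x‖ₑ ^ 2 ∂μ := by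
  have h1 : ‖∫ x, f x ∂μ‖ₑ ≤ ∫⁻ x, ‖f x‖ₑ ∂μ := enorm_integral_le_lintegral_enorm f
  have h2 := ENNReal.lintegral_mul_le_Lp_mul_Lq μ (p := 2) (q := 2)
    (Real.HolderConjugate.two_two) (aemeasurable_const (b := (1 : ℝ≥0∞))) hf.enorm
  simp only [Pi.mul_apply, one_mul, ENNReal.one_rpow, lintegral_const] at h2
  calc _ ≤ (μ Set.univ ^ (1 / 2 : ℝ) * (∫⁻ x, ‖f x‖ₑ ^ (2 : ℝ) ∂μ) ^ (1 / 2 : ℝ)) ^ 2 := by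
        gcongr
        exact h1.trans h2
    _ = _ := by
        rw [mul_pow, ← ENNReal.rpow_natCast, ← ENNReal.rpow_natCast, ← ENNReal.rpow_mul,
          ← ENNReal.rpow_mul]
        simp

/-- An integral estimate for the Fourier transform along the level sets of `y₁² + y₂²`. -/
theorem lintegral_enorm_integral_exp_sq_le {F : ℝ × ℝ → ℂ} (hm : Measurable F)
    (hi : Integrable F) {M : ℝ} (hM : ∀ y, ‖F y‖ ≤ M) :
    ∫⁻ t : ℝ, ‖∫ y : ℝ × ℝ, Complex.exp ((-2 * Real.pi * (y.1 ^ 2 + y.2 ^ 2) * t : ℝ) * Complex.I)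
        • F y‖ₑ ^ 2 ≤ ENNReal.ofReal Real.pi * ∫⁻ y, ‖F y‖ₑ ^ 2 := by
  have hΦ := measurable_sqPolar
  have hi2 : Integrable (fun p => F (sqPolar p)) sqPolarMeasure :=
    measurePreserving_sqPolar.integrable_comp_of_integrable (hi.smul_measure (by finiteness))
  set A : ℝ → ℂ := (Set.Ioi (0 : ℝ)).indicator
    fun ρ => 2⁻¹ * ∫ θ in Set.Ioo (-Real.pi) Real.pi, F (sqPolar (ρ, θ)) with hA
  have hAm0 : Measurable fun ρ => 2⁻¹ * ∫ θ in Set.Ioo (-Real.pi) Real.pi, F (sqPolar (ρ, θ)) := by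
    refine Measurable.const_mul (StronglyMeasurable.measurable ?_) _
    refine StronglyMeasurable.integral_prod_right
      (f := fun ρ θ => F (sqPolar (ρ, θ))) ?_
    exact (hm.comp hΦ).stronglyMeasurable
  have hAb : BddInt A := by
    refine ⟨hAm0.indicator measurableSet_Ioi, ?_, ?_⟩
    · rw [hA, integrable_indicator_iff measurableSet_Ioi]
      exact (Integrable.integral_prod_left hi2).const_mul _
    · refine ⟨2⁻¹ * (M * (volume.restrict (Set.Ioo (-Real.pi) Real.pi)).real Set.univ),
        fun ρ => ?_⟩
      have hM0 : 0 ≤ M := (norm_nonneg _).trans (hM 0)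
      refine (norm_indicator_le_norm_self _ _).trans ?_
      rw [norm_mul]
      gcongr
      · simp
      · exact norm_integral_le_of_norm_le_const (Filter.Eventually.of_forall fun θ => hM _)
  have e1 : ∀ t : ℝ, ∫ y : ℝ × ℝ,
      Complex.exp ((-2 * Real.pi * (y.1 ^ 2 + y.2 ^ 2) * t : ℝ) * Complex.I) • F y = 𝓕 A t := by
    intro t
    set k : ℝ × ℝ → ℂ := fun y =>
      Complex.exp ((-2 * Real.pi * (y.1 ^ 2 + y.2 ^ 2) * t : ℝ) * Complex.I) • F y with hk
    have hkm : Measurable k := by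
      rw [hk]
      simp only [smul_eq_mul]
      fun_prop
    have hki : Integrable k := hi.mono hkm.aestronglyMeasurable
      (Filter.Eventually.of_forall fun y => by
        rw [hk, norm_smul, Complex.norm_exp_ofReal_mul_I, one_mul])
    have hki2 : Integrable (fun p => k (sqPolar p)) sqPolarMeasure :=
      measurePreserving_sqPolar.integrable_comp_of_integrable (hki.smul_measure (by finiteness))
    have h1 : ∫ p, k (sqPolar p) ∂sqPolarMeasure = 2 * ∫ y, k y := by
      rw [← integral_map measurable_sqPolar.aemeasurable hkm.aestronglyMeasurable,
        measurePreserving_sqPolar.map_eq, integral_smul_measure]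
      simp
    have h2 : ∫ y, k y = 2⁻¹ * ∫ p, k (sqPolar p) ∂sqPolarMeasure := by
      rw [h1]; ring
    rw [h2, sqPolarMeasure, integral_prod _ hki2, Real.fourier_real_eq_integral_exp_smul,
      ← integral_const_mul, ← integral_indicator measurableSet_Ioi]
    refine integral_congr_ae (Filter.Eventually.of_forall fun ρ => ?_)
    simp only [hA, Set.indicator]
    split_ifs with hρ
    · have hρ' : (0 : ℝ) < ρ := hρ
      have h3 : ∀ θ, (√ρ * Real.cos θ) ^ 2 + (√ρ * Real.sin θ) ^ 2 = ρ := fun θ => by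
        rw [mul_pow, mul_pow, ← mul_add, Real.cos_sq_add_sin_sq, mul_one, Real.sq_sqrt hρ'.le]
      simp only [hk, sqPolar, h3, smul_eq_mul, integral_const_mul]
      ring
    · simp
  simp_rw [e1]
  rw [hAb.lintegral_fourier]
  have e2 : ∀ ρ, ‖A ρ‖ₑ ^ 2 ≤ (Set.Ioi (0 : ℝ)).indicator (fun ρ => ENNReal.ofReal (Real.pi / 2) *
      ∫⁻ θ in Set.Ioo (-Real.pi) Real.pi, ‖F (sqPolar (ρ, θ))‖ₑ ^ 2) ρ := fun ρ => by
    simp only [hA, Set.indicator]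
    split_ifs with hρ
    · rw [enorm_mul, mul_pow]
      have h4 := enorm_integral_sq_le_of_finite
        (μ := volume.restrict (Set.Ioo (-Real.pi) Real.pi)) (f := fun θ => F (sqPolar (ρ, θ)))
        (hm.comp (hΦ.comp measurable_prodMk_left)).aestronglyMeasurable
      refine (mul_le_mul_right h4 _).trans_eq ?_
      rw [← mul_assoc]
      congr 1
      simp only [Measure.restrict_apply_univ, Real.volume_Ioo]
      rw [← ofReal_norm, norm_inv, Complex.norm_ofNat, ← ENNReal.ofReal_pow (by norm_num),
        ← ENNReal.ofReal_mul (by norm_num)]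
      congr 1
      ring
    · simp
  refine (lintegral_mono e2).trans_eq ?_
  rw [lintegral_indicator measurableSet_Ioi, lintegral_const_mul' _ _ (by finiteness)]
  have hmm : Measurable fun y => ‖F y‖ₑ ^ 2 := by fun_prop
  have h5 := lintegral_sqPolar hmm
  rw [sqPolarMeasure, lintegral_prod _ (by fun_prop)] at h5
  rw [h5, ← mul_assoc]
  congr 1
  rw [← ENNReal.ofReal_ofNat, ← ENNReal.ofReal_mul (by positivity)]
  congr 1
  ring

section

variable {g : ℝ → ℂ}

/-- The threefold tensor product of `g` on the plane of triples with sum `K`, in coordinates in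
which the sum of the squares is `K² / 3 + 2 (y₁² + y₂²)`. -/
def planeTensor (g : ℝ → ℂ) (K : ℝ) (y : ℝ × ℝ) : ℂ :=
  g (K / 3 + y.1 / √3 + y.2) * g (K / 3 + y.1 / √3 - y.2) * g (K / 3 - 2 * (y.1 / √3))

theorem measurable_planeTensor (hg : Measurable g) (K : ℝ) : Measurable (planeTensor g K) := by
  unfold planeTensor
  fun_prop

theorem BddInt.integrable_planeTensor (hg : BddInt g) (K : ℝ) : Integrable (planeTensor g K) := by
  obtain ⟨M, hM⟩ := hg.bdd
  have hgm := hg.meas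
  have hM0 : 0 ≤ M := (norm_nonneg _).trans (hM 0)
  have hP := measurable_planeTensor hg.meas K
  refine ⟨hP.aestronglyMeasurable, ?_⟩
  have hle : ∀ y : ℝ × ℝ, ‖planeTensor g K y‖ₑ ≤
      ENNReal.ofReal M * (‖g (K / 3 - 2 * (y.1 / √3))‖ₑ * ‖g (K / 3 + y.1 / √3 + y.2)‖ₑ) := by
    intro y
    rw [planeTensor, enorm_mul, enorm_mul]
    have : ‖g (K / 3 + y.1 / √3 - y.2)‖ₑ ≤ ENNReal.ofReal M := by
      rw [← ofReal_norm]; exact ENNReal.ofReal_le_ofReal (hM _)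
    calc _ ≤ ‖g (K / 3 + y.1 / √3 + y.2)‖ₑ * ENNReal.ofReal M * ‖g (K / 3 - 2 * (y.1 / √3))‖ₑ := by
          gcongr
      _ = _ := by ring
  have hfin : ∫⁻ x, ‖g x‖ₑ < ∞ := hg.int.2
  refine (lintegral_mono hle).trans_lt ?_
  rw [lintegral_const_mul' _ _ ENNReal.ofReal_ne_top, Measure.volume_eq_prod,
    lintegral_prod _ (by fun_prop)]
  have e1 : ∀ c : ℝ, ∫⁻ u, ‖g (K / 3 - 2 * (c / √3))‖ₑ * ‖g (K / 3 + c / √3 + u)‖ₑ =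
      ‖g (K / 3 - 2 * (c / √3))‖ₑ * ∫⁻ x, ‖g x‖ₑ := fun c => by
    rw [lintegral_const_mul' _ _ (by finiteness),
      lintegral_add_left_eq_self (fun x => ‖g x‖ₑ) (K / 3 + c / √3)]
  simp_rw [e1]
  rw [lintegral_mul_const' _ _ hfin.ne]
  have e2 : ∫⁻ c : ℝ, ‖g (K / 3 - 2 * (c / √3))‖ₑ = ENNReal.ofReal |(2 / √3)⁻¹| * ∫⁻ x, ‖g x‖ₑ := by
    rw [← lintegral_sub_left_eq_self (fun x => ‖g x‖ₑ) (K / 3),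
      ← lintegral_comp_mul_left (by positivity) (fun x => ‖g (K / 3 - x)‖ₑ)]
    congr 1
    funext c
    congr 3
    ring
  rw [e2]
  finiteness

/-- The sum of squares in the coordinates of `planeTensor`. -/
theorem symbol_mul_symbol_mul_symbol (r K c u : ℝ) :
    schrodingerSymbol r (K / 3 + c / √3 + u) * schrodingerSymbol r (K / 3 + c / √3 - u) *
      schrodingerSymbol r (K / 3 - 2 * (c / √3)) =
    Complex.exp ((-(4 * Real.pi ^ 2 * r * K ^ 2 / 3) : ℝ) * Complex.I) *
      Complex.exp ((-2 * Real.pi * (c ^ 2 + u ^ 2) * (4 * Real.pi * r) : ℝ) * Complex.I) := by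
  unfold schrodingerSymbol
  rw [← Complex.exp_add, ← Complex.exp_add, ← Complex.exp_add]
  congr 1
  have h3 : (c / √3) ^ 2 = c ^ 2 / 3 := by rw [div_pow, Real.sq_sqrt (by norm_num)]
  have : r * (2 * Real.pi * (K / 3 + c / √3 + u)) ^ 2 + r * (2 * Real.pi * (K / 3 + c / √3 - u)) ^ 2
      + r * (2 * Real.pi * (K / 3 - 2 * (c / √3))) ^ 2 =
      4 * Real.pi ^ 2 * r * K ^ 2 / 3 + 2 * Real.pi * (c ^ 2 + u ^ 2) * (4 * Real.pi * r) := by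
    linear_combination (24 * Real.pi ^ 2 * r) * h3
  have h4 := congrArg (fun z : ℝ => -(z : ℂ) * Complex.I) this
  simp only [Complex.ofReal_add] at h4
  simp only [neg_mul, Complex.ofReal_neg] at h4 ⊢
  linear_combination h4

theorem conv_conv_eq (a : ℝ → ℂ) (K : ℝ) :
    convolution (convolution a a (ContinuousLinearMap.mul ℂ ℂ) volume) a
      (ContinuousLinearMap.mul ℂ ℂ) volume K =
    (2 / √3 : ℝ) * ∫ c, ∫ u, planeTensor a K (c, u) := by
  unfold convolution
  simp only [ContinuousLinearMap.mul_apply']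
  have e1 : ∀ s : ℝ, (∫ t, a t * a (s - t)) * a (K - s) =
      ∫ u, a (s / 2 + u) * a (s / 2 - u) * a (K - s) := fun s => by
    rw [integral_mul_const, ← integral_add_left_eq_self (fun t => a t * a (s - t)) (s / 2)]
    congr 2
    funext u
    congr 2
    ring
  simp_rw [e1]
  rw [← integral_add_left_eq_self _ (2 * K / 3)]
  have h2 := Measure.integral_comp_mul_left
    (fun s => ∫ u, a ((2 * K / 3 + s) / 2 + u) * a ((2 * K / 3 + s) / 2 - u) *
      a (K - (2 * K / 3 + s))) (2 / √3)
  have h3 : |(2 / √3)⁻¹| = (2 / √3)⁻¹ := abs_of_pos (by positivity)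
  have h4 : (2 / √3 : ℝ) ≠ 0 := by positivity
  rw [h3] at h2
  have h5 := congrArg (fun z : ℂ => ((2 / √3 : ℝ) : ℂ) * z) h2
  simp only [Complex.real_smul] at h5
  rw [← mul_assoc, ← Complex.ofReal_mul, mul_inv_cancel₀ h4, Complex.ofReal_one, one_mul] at h5
  rw [← h5]
  congr 2
  funext c
  congr 1
  funext u
  unfold planeTensor
  dsimp only
  congr 1
  · congr 2 <;> ring
  · congr 1; ring

theorem lintegral_evol_six_space (hg : BddInt g) (r : ℝ) :
    ∫⁻ x, ‖evol g r x‖ₑ ^ 6 = ENNReal.ofReal (4 / 3) * ∫⁻ K, ‖∫ y : ℝ × ℝ,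
      Complex.exp ((-2 * Real.pi * (y.1 ^ 2 + y.2 ^ 2) * (4 * Real.pi * r) : ℝ) * Complex.I)
        • planeTensor g K y‖ₑ ^ 2 := by
  set a : ℝ → ℂ := fun ξ => schrodingerSymbol r ξ * g ξ with ha
  have hA : BddInt a := hg.symbol_mul r
  have e : ∀ x, ‖evol g r x‖ₑ ^ 6 =
      ‖𝓕⁻ (convolution (convolution a a (ContinuousLinearMap.mul ℂ ℂ) volume) a
        (ContinuousLinearMap.mul ℂ ℂ) volume) x‖ₑ ^ 2 := fun x => by
    rw [fourierInv_mul_convolution (hA.convolution hA).int hA.int,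
      fourierInv_mul_convolution hA.int hA.int, enorm_mul, enorm_mul]
    simp only [evol, ha]
    ring
  simp_rw [e]
  rw [((hA.convolution hA).convolution hA).lintegral_fourierInv,
    ← lintegral_const_mul' _ _ ENNReal.ofReal_ne_top]
  congr 1
  funext K
  have e2 : ∀ y : ℝ × ℝ, planeTensor a K y =
      Complex.exp ((-(4 * Real.pi ^ 2 * r * K ^ 2 / 3) : ℝ) * Complex.I) *
        (Complex.exp ((-2 * Real.pi * (y.1 ^ 2 + y.2 ^ 2) * (4 * Real.pi * r) : ℝ) * Complex.I) •
          planeTensor g K y) := fun y => by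
    rw [smul_eq_mul, ← mul_assoc, ← symbol_mul_symbol_mul_symbol]
    simp only [planeTensor, ha]
    ring
  have hint := hA.integrable_planeTensor K
  rw [conv_conv_eq, ← integral_prod (planeTensor a K) hint, ← Measure.volume_eq_prod]
  simp_rw [e2]
  rw [integral_const_mul, enorm_mul, enorm_mul, ← ofReal_norm (Complex.exp _),
    Complex.norm_exp_ofReal_mul_I, ENNReal.ofReal_one, one_mul, mul_pow]
  congr 1
  rw [← ofReal_norm, Complex.norm_real, Real.norm_of_nonneg (by positivity),
    ← ENNReal.ofReal_pow (by positivity), div_pow, Real.sq_sqrt (by norm_num)]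
  norm_num

theorem lintegral_planeTensor_sq (hg : Measurable g) :
    ∫⁻ K, ∫⁻ y, ‖planeTensor g K y‖ₑ ^ 2 = ENNReal.ofReal (√3 / 2) * (∫⁻ t, ‖g t‖ₑ ^ 2) ^ 3 := by
  set G : ℝ → ℝ≥0∞ := fun t => ‖g t‖ₑ ^ 2 with hG
  have hGm : Measurable G := by fun_prop
  have hGt : ∀ x, G x ≠ ∞ := fun x => by simp only [hG]; finiteness
  have e0 : ∀ K, ∫⁻ y, ‖planeTensor g K y‖ₑ ^ 2 = ∫⁻ c, ∫⁻ u,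
      G (K / 3 - 2 * (c / √3)) * (G (K / 3 + c / √3 + u) * G (K / 3 + c / √3 - u)) := fun K => by
    have := measurable_planeTensor hg K
    rw [Measure.volume_eq_prod, lintegral_prod _ (by fun_prop)]
    refine lintegral_congr fun c => lintegral_congr fun u => ?_
    simp only [planeTensor, enorm_mul, mul_pow, hG]
    ring
  simp_rw [e0]
  rw [lintegral_lintegral_swap (by exact Measurable.aemeasurable (by fun_prop))]
  have e1 : ∀ c, ∫⁻ K, ∫⁻ u,
      G (K / 3 - 2 * (c / √3)) * (G (K / 3 + c / √3 + u) * G (K / 3 + c / √3 - u)) =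
      ENNReal.ofReal 3 * ∫⁻ k, ∫⁻ u, G k * (G (k + √3 * c + u) * G (k + √3 * c - u)) := fun c => by
    rw [← lintegral_sub_right_eq_self
      (fun k => ∫⁻ u, G k * (G (k + √3 * c + u) * G (k + √3 * c - u))) (2 * (c / √3))]
    have := lintegral_comp_mul_left (a := 1 / 3) (by norm_num) (fun k => ∫⁻ u,
      G (k - 2 * (c / √3)) * (G (k - 2 * (c / √3) + √3 * c + u) *
        G (k - 2 * (c / √3) + √3 * c - u)))
    rw [show |(1 / 3 : ℝ)⁻¹| = 3 by norm_num] at this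
    rw [← this]
    have h3 : √3 * c = 3 * (c / √3) := by
      have : √3 * √3 = 3 := Real.mul_self_sqrt (by norm_num)
      field_simp
      linear_combination c * this
    refine lintegral_congr fun K => lintegral_congr fun u => ?_
    rw [h3]
    congr 3 <;> ring
  simp_rw [e1]
  rw [lintegral_const_mul' _ _ ENNReal.ofReal_ne_top,
    lintegral_lintegral_swap (by exact Measurable.aemeasurable (by fun_prop))]
  have e2 : ∀ k, ∫⁻ c, ∫⁻ u, G k * (G (k + √3 * c + u) * G (k + √3 * c - u)) =
      G k * (ENNReal.ofReal (√3)⁻¹ * (ENNReal.ofReal (1 / 2) * (∫⁻ t, G t) ^ 2)) := fun k => by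
    simp_rw [lintegral_const_mul' _ _ (hGt k)]
    congr 1
    rw [lintegral_comp_mul_left (by positivity) (fun c => ∫⁻ u, (G (k + c + u) * G (k + c - u))),
      abs_of_pos (by positivity),
      lintegral_add_left_eq_self (fun c => ∫⁻ u, (G (c + u) * G (c - u))) k]
    congr 1
    rw [lintegral_lintegral_swap (by exact Measurable.aemeasurable (by fun_prop))]
    have e3 : ∀ u, ∫⁻ c, G (c + u) * G (c - u) = ∫⁻ c, G c * G (c - 2 * u) := fun u => by
      rw [← lintegral_add_right_eq_self (fun c => G c * G (c - 2 * u)) u]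
      refine lintegral_congr fun c => ?_
      congr 2
      ring
    simp_rw [e3]
    rw [lintegral_lintegral_swap (by exact Measurable.aemeasurable (by fun_prop))]
    have e4 : ∀ c, ∫⁻ u, G c * G (c - 2 * u) = G c * (ENNReal.ofReal (1 / 2) * ∫⁻ t, G t) :=
      fun c => by
        rw [lintegral_const_mul' _ _ (hGt c),
          lintegral_comp_mul_left two_ne_zero (fun u => G (c - u)), lintegral_sub_left_eq_self G c,
          abs_of_pos (by norm_num), one_div]
    simp_rw [e4]
    rw [lintegral_mul_const _ hGm]
    ring
  simp_rw [e2]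
  rw [lintegral_mul_const _ hGm]
  have h6 : ENNReal.ofReal (√3 / 2) =
      ENNReal.ofReal 3 * (ENNReal.ofReal (√3)⁻¹ * ENNReal.ofReal (1 / 2)) := by
    rw [← ENNReal.ofReal_mul (by positivity), ← ENNReal.ofReal_mul (by positivity)]
    congr 1
    have : √3 * √3 = 3 := Real.mul_self_sqrt (by norm_num)
    field_simp
    linear_combination this
  rw [h6]
  ring

/-- The one-dimensional `L⁶` Strichartz estimate. -/
theorem lintegral_evol_six_le (hg : BddInt g) :
    ∫⁻ r, ∫⁻ x, ‖evol g r x‖ₑ ^ 6 ≤ (∫⁻ t, ‖g t‖ₑ ^ 2) ^ 3 := by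
  have hgm := hg.meas
  simp_rw [lintegral_evol_six_space hg]
  rw [lintegral_const_mul' _ _ ENNReal.ofReal_ne_top, lintegral_lintegral_swap]
  · have hK : ∀ K, ∫⁻ r : ℝ, ‖∫ y : ℝ × ℝ,
        Complex.exp ((-2 * Real.pi * (y.1 ^ 2 + y.2 ^ 2) * (4 * Real.pi * r) : ℝ) * Complex.I)
          • planeTensor g K y‖ₑ ^ 2 ≤ ENNReal.ofReal (1 / 4) * ∫⁻ y, ‖planeTensor g K y‖ₑ ^ 2 := by
      intro K
      obtain ⟨M, hM⟩ := hg.bdd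
      have hM0 : 0 ≤ M := (norm_nonneg _).trans (hM 0)
      have h1 := lintegral_enorm_integral_exp_sq_le (measurable_planeTensor hgm K)
        (hg.integrable_planeTensor K) (M := M * M * M) (fun y => by
          rw [planeTensor, norm_mul, norm_mul]
          gcongr <;> exact hM _)
      rw [lintegral_comp_mul_left (a := 4 * Real.pi) (by positivity) (fun t => ‖∫ y : ℝ × ℝ,
        Complex.exp ((-2 * Real.pi * (y.1 ^ 2 + y.2 ^ 2) * t : ℝ) * Complex.I)
          • planeTensor g K y‖ₑ ^ 2), abs_of_pos (by positivity)]
      refine (mul_le_mul_right h1 _).trans_eq ?_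
      rw [← mul_assoc, ← ENNReal.ofReal_mul (by positivity)]
      congr 2
      field_simp
    refine (mul_le_mul_right (lintegral_mono hK) _).trans ?_
    rw [lintegral_const_mul' _ _ ENNReal.ofReal_ne_top, lintegral_planeTensor_sq hgm, ← mul_assoc,
      ← mul_assoc, ← ENNReal.ofReal_mul (by positivity), ← ENNReal.ofReal_mul (by positivity)]
    refine mul_le_of_le_one_left' (ENNReal.ofReal_le_one.2 ?_)
    have : √3 ≤ 3 := Real.sqrt_le_iff.2 ⟨by norm_num, by norm_num⟩
    linarith
  · refine Measurable.aemeasurable ((Measurable.enorm ?_).pow_const 2)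
    refine StronglyMeasurable.measurable ?_
    refine StronglyMeasurable.integral_prod_right ?_
    refine Measurable.stronglyMeasurable ?_
    simp only [smul_eq_mul, planeTensor]
    fun_prop

end

theorem lintegral_enorm_sq_eq (f : L2R) : ∫⁻ x, ‖f x‖ₑ ^ 2 = ‖f‖ₑ ^ 2 := by
  rw [Lp.enorm_def, eLpNorm_eq_lintegral_rpow_enorm_toReal (by norm_num) (by norm_num),
    ← ENNReal.rpow_natCast, ← ENNReal.rpow_mul]
  simp

theorem enorm_fourier_eq (f : L2R) : ‖(𝓕 f : L2R)‖ₑ = ‖f‖ₑ := by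
  rw [← ofReal_norm, Lp.norm_fourier_eq, ofReal_norm]

theorem enorm_fourierInv_eq (f : L2R) : ‖(𝓕⁻ f : L2R)‖ₑ = ‖f‖ₑ := by
  rw [← enorm_fourier_eq, FourierTransform.fourier_fourierInv_eq]

theorem coeFn_fourierInv_sub (f g : L2R) :
    ((𝓕⁻ (f - g) : L2R) : ℝ → ℂ) =ᵐ[volume] fun x => (𝓕⁻ f : L2R) x - (𝓕⁻ g : L2R) x := by
  have : (𝓕⁻ (f - g) : L2R) = 𝓕⁻ f - 𝓕⁻ g :=
    (Lp.fourierTransformₗᵢ ℝ ℂ).symm.map_sub f g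
  rw [this]
  exact Lp.coeFn_sub _ _

theorem lintegral_freeEvolution_sub_fourierInv {a : ℝ → ℂ} (h1 : Integrable a)
    (h2 : MemLp a 2 volume) (f : L2R) (r : ℝ) :
    ∫⁻ x, ‖freeEvolution r f x - 𝓕⁻ a x‖ₑ ^ 2 =
      ∫⁻ ξ, ‖schrodingerSymbol r ξ * (𝓕 f : L2R) ξ - a ξ‖ₑ ^ 2 := by
  set A : L2R := (memLp_schrodingerSymbol_mul r (𝓕 f)).toLp _ with hA
  have h3 : (fun x => freeEvolution r f x - 𝓕⁻ a x) =ᵐ[volume] (𝓕⁻ (A - h2.toLp a) : L2R) := by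
    filter_upwards [coeFn_fourierInv_sub A (h2.toLp a), fourierInv_toLp_ae_eq h1 h2] with x hx hx2
    rw [hx, hx2]
    rfl
  calc _ = ∫⁻ x, ‖(𝓕⁻ (A - h2.toLp a) : L2R) x‖ₑ ^ 2 :=
        lintegral_congr_ae (by filter_upwards [h3] with x hx; rw [hx])
    _ = ∫⁻ ξ, ‖(A - h2.toLp a : L2R) ξ‖ₑ ^ 2 := by
        rw [lintegral_enorm_sq_eq, lintegral_enorm_sq_eq, enorm_fourierInv_eq]
    _ = _ := by
        refine lintegral_congr_ae ?_
        filter_upwards [Lp.coeFn_sub A (h2.toLp a),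
          (memLp_schrodingerSymbol_mul r (𝓕 f)).coeFn_toLp, h2.coeFn_toLp] with ξ h3 h4 h5
        rw [h3, Pi.sub_apply, hA, h4, h5]

/-- The evolution operator on `L²` is compared in mean square with the explicit evolution of a
bounded integrable approximation of the Fourier transform. -/
theorem lintegral_freeEvolution_sub_evol {g : ℝ → ℂ} (hg : BddInt g) (f : L2R) (r : ℝ) :
    ∫⁻ x, ‖freeEvolution r f x - evol g r x‖ₑ ^ 2 = ∫⁻ ξ, ‖(𝓕 f : L2R) ξ - g ξ‖ₑ ^ 2 := by
  have hs := hg.symbol_mul r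
  refine (lintegral_freeEvolution_sub_fourierInv hs.int hs.memLp_two f r).trans ?_
  refine lintegral_congr fun ξ => ?_
  rw [← mul_sub, enorm_mul, ← ofReal_norm (schrodingerSymbol r ξ), norm_schrodingerSymbol,
    ENNReal.ofReal_one, one_mul]

theorem enorm_freeEvolution (r : ℝ) (f : L2R) : ‖freeEvolution r f‖ₑ = ‖f‖ₑ := by
  have h : BddInt (fun _ => (0 : ℂ)) := ⟨measurable_const, integrable_zero _ _ _, 0, by simp⟩
  have h2 := lintegral_freeEvolution_sub_evol h f r
  have h3 : ∀ x, evol (fun _ => (0 : ℂ)) r x = 0 := fun x => by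
    unfold evol
    rw [Real.fourierInv_eq']
    simp
  simp only [h3, sub_zero] at h2
  rw [lintegral_enorm_sq_eq, lintegral_enorm_sq_eq, enorm_fourier_eq] at h2
  exact (ENNReal.pow_right_strictMono two_ne_zero).injective h2

theorem measurable_evol_space {g : ℝ → ℂ} (hg : Measurable g) (r : ℝ) : Measurable (evol g r) := by
  have h := (measurable_evol hg).comp (measurable_prodMk_left (x := r))
  simpa only [Function.comp_def] using h

/-- Truncation of `G` in the variable and in the modulus. -/
def trunc (G : ℝ → ℂ) (n : ℕ) : ℝ → ℂ :=
  Set.indicator {ξ : ℝ | |ξ| ≤ n ∧ ‖G ξ‖ ≤ n} G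

theorem norm_trunc_le (G : ℝ → ℂ) (n : ℕ) (ξ : ℝ) : ‖trunc G n ξ‖ ≤ ‖G ξ‖ :=
  norm_indicator_le_norm_self _ _

theorem bddInt_trunc {G : ℝ → ℂ} (hG : Measurable G) (n : ℕ) : BddInt (trunc G n) := by
  have hS : MeasurableSet {ξ : ℝ | |ξ| ≤ n ∧ ‖G ξ‖ ≤ n} :=
    MeasurableSet.inter (s₁ := {ξ : ℝ | |ξ| ≤ n}) (s₂ := {ξ : ℝ | ‖G ξ‖ ≤ n})
      (measurableSet_le measurable_id.abs measurable_const)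
      (measurableSet_le hG.norm measurable_const)
  have hm : Measurable (trunc G n) := hG.indicator hS
  have hb : ∀ ξ, ‖trunc G n ξ‖ ≤ (Set.Icc (-n : ℝ) n).indicator (fun _ => (n : ℝ)) ξ := fun ξ => by
    unfold trunc
    by_cases h : ξ ∈ {ξ : ℝ | |ξ| ≤ n ∧ ‖G ξ‖ ≤ n}
    · rw [Set.indicator_of_mem h, Set.indicator_of_mem (Set.mem_Icc.2 (abs_le.1 h.1))]
      exact h.2
    · rw [Set.indicator_of_notMem h, norm_zero]
      exact Set.indicator_nonneg (fun _ _ => by positivity) _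
  refine ⟨hm, ?_, n, fun ξ => (hb ξ).trans ?_⟩
  · refine Integrable.mono' (g := (Set.Icc (-n : ℝ) n).indicator (fun _ => (n : ℝ))) ?_
      hm.aestronglyMeasurable (Filter.Eventually.of_forall hb)
    rw [integrable_indicator_iff measurableSet_Icc]
    exact integrableOn_const (by simp)
  · exact Set.indicator_le_self' (fun _ _ => by positivity) _

theorem tendsto_lintegral_sub_trunc {G : ℝ → ℂ} (hG : Measurable G)
    (hG2 : ∫⁻ ξ, ‖G ξ‖ₑ ^ 2 ≠ ∞) :
    Filter.Tendsto (fun n => ∫⁻ ξ, ‖G ξ - trunc G n ξ‖ₑ ^ 2) Filter.atTop (𝓝 0) := by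
  have h := tendsto_lintegral_of_dominated_convergence (μ := volume)
    (F := fun n ξ => ‖G ξ - trunc G n ξ‖ₑ ^ 2) (f := fun _ => 0) (fun ξ => ‖G ξ‖ₑ ^ 2)
    (fun n => by have := (bddInt_trunc hG n).meas; fun_prop)
    (fun n => Filter.Eventually.of_forall fun ξ => by
      dsimp only
      gcongr
      unfold trunc Set.indicator
      split_ifs <;> simp) hG2
    (Filter.Eventually.of_forall fun ξ => by
      refine tendsto_const_nhds.congr' ?_
      obtain ⟨N, hN⟩ := exists_nat_ge (max |ξ| ‖G ξ‖)
      filter_upwards [Filter.eventually_ge_atTop N] with n hn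
      have hn' : (N : ℝ) ≤ n := by exact_mod_cast hn
      have hmem : ξ ∈ {ξ : ℝ | |ξ| ≤ n ∧ ‖G ξ‖ ≤ n} :=
        ⟨(le_max_left _ _).trans (hN.trans hn'), (le_max_right _ _).trans (hN.trans hn')⟩
      rw [trunc, Set.indicator_of_mem hmem]
      simp)
  simpa using h

theorem tendsto_of_tsum_enorm_sub_sq {u : ℕ → ℂ} {v : ℂ} (h : ∑' k, ‖v - u k‖ₑ ^ 2 ≠ ∞) :
    Filter.Tendsto u Filter.atTop (𝓝 v) := by
  have h1 := ENNReal.tendsto_atTop_zero_of_tsum_ne_top h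
  rw [tendsto_iff_edist_tendsto_0]
  have h2 := (ENNReal.continuous_rpow_const (y := (1 / 2 : ℝ))).tendsto 0 |>.comp h1
  rw [ENNReal.zero_rpow_of_pos (by norm_num)] at h2
  refine h2.congr fun k => ?_
  rw [Function.comp_apply, edist_comm, edist_eq_enorm_sub, ← ENNReal.rpow_natCast,
    ← ENNReal.rpow_mul]
  simp

/-- Approximation of the evolution by explicit ones, almost everywhere for every time. -/
theorem exists_evol_approx (f : L2R) {G : ℝ → ℂ} (hG : Measurable G)
    (hGf : G =ᵐ[volume] (𝓕 f : L2R)) :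
    ∃ φ : ℕ → ℝ → ℂ, (∀ k, BddInt (φ k)) ∧ (∀ k ξ, ‖φ k ξ‖ ≤ ‖G ξ‖) ∧
      ∑' k, ∫⁻ ξ, ‖G ξ - φ k ξ‖ₑ ^ 2 ≠ ∞ ∧ ∀ r, ∀ᵐ x, Filter.Tendsto (fun k => evol (φ k) r x) Filter.atTop
        (𝓝 (freeEvolution r f x)) := by
  have hG2 : ∫⁻ ξ, ‖G ξ‖ₑ ^ 2 ≠ ∞ := by
    have : ∫⁻ ξ, ‖G ξ‖ₑ ^ 2 = ∫⁻ ξ, ‖(𝓕 f : L2R) ξ‖ₑ ^ 2 :=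
      lintegral_congr_ae (by filter_upwards [hGf] with ξ h; rw [h])
    rw [this, lintegral_enorm_sq_eq]
    finiteness
  obtain ⟨ε, hε0, hε⟩ := ENNReal.exists_pos_sum_of_countable (ι := ℕ) (ε := 1) one_ne_zero
  have h1 : ∀ k, ∃ n, ∫⁻ ξ, ‖G ξ - trunc G n ξ‖ₑ ^ 2 < ε k := fun k =>
    ((tendsto_lintegral_sub_trunc hG hG2).eventually_lt_const
      (ENNReal.coe_pos.2 (hε0 k))).exists
  choose n hn using h1
  refine ⟨fun k => trunc G (n k), fun k => bddInt_trunc hG _, fun k ξ => norm_trunc_le _ _ _,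
    ne_top_of_le_ne_top ENNReal.one_ne_top
      ((ENNReal.tsum_le_tsum fun k => (hn k).le).trans hε.le), fun r => ?_⟩
  have hm : ∀ k, AEMeasurable
      (fun x => ‖freeEvolution r f x - evol (trunc G (n k)) r x‖ₑ ^ 2) volume := fun k => by
    have h2 := measurable_evol_space (bddInt_trunc hG (n k)).meas r
    have h3 := (Lp.stronglyMeasurable (freeEvolution r f)).measurable
    exact ((h3.sub h2).enorm.pow_const 2).aemeasurable
  have h4 : ∫⁻ x, ∑' k, ‖freeEvolution r f x - evol (trunc G (n k)) r x‖ₑ ^ 2 ≠ ∞ := by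
    rw [lintegral_tsum hm]
    refine ne_top_of_le_ne_top ENNReal.one_ne_top (le_trans (ENNReal.tsum_le_tsum fun k => ?_)
      hε.le)
    rw [lintegral_freeEvolution_sub_evol (bddInt_trunc hG (n k))]
    refine le_trans (le_of_eq (lintegral_congr_ae ?_)) (hn k).le
    filter_upwards [hGf] with ξ h
    rw [h]
  filter_upwards [ae_lt_top' (AEMeasurable.tsum hm) h4] with x hx
  exact tendsto_of_tsum_enorm_sub_sq hx.ne

theorem lintegral_enorm_sq_le_of_norm_le {f : L2R} {G φ : ℝ → ℂ}
    (hGf : G =ᵐ[volume] (𝓕 f : L2R)) (h : ∀ ξ, ‖φ ξ‖ ≤ ‖G ξ‖) :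
    ∫⁻ ξ, ‖φ ξ‖ₑ ^ 2 ≤ ‖f‖ₑ ^ 2 := by
  rw [← enorm_fourier_eq, ← lintegral_enorm_sq_eq]
  refine lintegral_mono_ae ?_
  filter_upwards [hGf] with ξ hξ
  gcongr
  rw [← hξ]
  exact enorm_le_iff_norm_le.2 (h ξ)

/-- The evolution has a jointly measurable version. -/
theorem exists_measurable_freeEvolution (f : L2R) :
    ∃ u : ℝ × ℝ → ℂ, Measurable u ∧ ∀ r, ∀ᵐ x, freeEvolution r f x = u (r, x) := by
  obtain ⟨φ, hφ, -, -, hlim⟩ := exists_evol_approx f (Lp.stronglyMeasurable (𝓕 f : L2R)).measurable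
    Filter.EventuallyEq.rfl
  refine ⟨fun p => Filter.limUnder Filter.atTop fun k => evol (φ k) p.1 p.2, ?_, fun r => ?_⟩
  · exact (StronglyMeasurable.limUnder
      fun k => (measurable_evol (hφ k).meas).stronglyMeasurable).measurable
  · filter_upwards [hlim r] with x hx
    exact hx.limUnder_eq.symm

theorem lintegral_lintegral_le_of_tendsto {w : ℕ → ℝ × ℝ → ℝ≥0∞} {v : ℝ → ℝ → ℝ≥0∞} {C : ℝ≥0∞}
    (hw : ∀ k, Measurable (w k)) (hC : ∀ k, ∫⁻ r, ∫⁻ x, w k (r, x) ≤ C)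
    (hlim : ∀ r, ∀ᵐ x, Filter.Tendsto (fun k => w k (r, x)) Filter.atTop (𝓝 (v r x))) :
    ∫⁻ r, ∫⁻ x, v r x ≤ C := by
  calc ∫⁻ r, ∫⁻ x, v r x
      = ∫⁻ r, ∫⁻ x, Filter.liminf (fun k => w k (r, x)) Filter.atTop :=
        lintegral_congr fun r => lintegral_congr_ae <| by
          filter_upwards [hlim r] with x hx
          exact hx.liminf_eq.symm
    _ ≤ ∫⁻ r, Filter.liminf (fun k => ∫⁻ x, w k (r, x)) Filter.atTop :=
        lintegral_mono fun r => lintegral_liminf_le fun k => (hw k).comp measurable_prodMk_left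
    _ ≤ Filter.liminf (fun k => ∫⁻ r, ∫⁻ x, w k (r, x)) Filter.atTop :=
        lintegral_liminf_le fun k => (hw k).lintegral_prod_right'
    _ ≤ C := Filter.liminf_le_of_le (by isBoundedDefault) fun b hb => by
        obtain ⟨k, hk⟩ := hb.exists
        exact hk.trans (hC k)

/-- The one-dimensional `L⁶` Strichartz estimate. -/
theorem lintegral_freeEvolution_six_le (f : L2R) :
    ∫⁻ r, ∫⁻ x, ‖freeEvolution r f x‖ₑ ^ 6 ≤ ‖f‖ₑ ^ 6 := by
  obtain ⟨φ, hφ, hle, -, hlim⟩ := exists_evol_approx f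
    (Lp.stronglyMeasurable (𝓕 f : L2R)).measurable Filter.EventuallyEq.rfl
  refine lintegral_lintegral_le_of_tendsto (w := fun k p => ‖evol (φ k) p.1 p.2‖ₑ ^ 6)
    (fun k => (measurable_evol (hφ k).meas).enorm.pow_const 6) (fun k => ?_) fun r => ?_
  · refine (lintegral_evol_six_le (hφ k)).trans ?_
    rw [show (6 : ℕ) = 2 * 3 from rfl, pow_mul]
    gcongr
    exact lintegral_enorm_sq_le_of_norm_le Filter.EventuallyEq.rfl (hle k)
  · filter_upwards [hlim r] with x hx
    exact ((ENNReal.continuous_pow 6).tendsto _).comp hx.enorm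

/-- The bilinear estimate for functions with separated frequencies. -/
theorem lintegral_freeEvolution_mul_le (f h : L2R) {A B : Set ℝ} (hA : MeasurableSet A)
    (hB : MeasurableSet B) (hfA : ∀ᵐ ξ, ξ ∉ A → (𝓕 f : L2R) ξ = 0)
    (hhB : ∀ᵐ ξ, ξ ∉ B → (𝓕 h : L2R) ξ = 0) {δ : ℝ} (hδ : 0 < δ)
    (hsep : ∀ ξ ∈ A, ∀ η ∈ B, δ ≤ |ξ - η|) :
    ∫⁻ r, ∫⁻ x, ‖freeEvolution r f x‖ₑ ^ 2 * ‖freeEvolution r h x‖ₑ ^ 2 ≤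
      ENNReal.ofReal (1 / δ) * (‖f‖ₑ ^ 2 * ‖h‖ₑ ^ 2) := by
  have key : ∀ (f : L2R) {A : Set ℝ}, (∀ᵐ ξ, ξ ∉ A → (𝓕 f : L2R) ξ = 0) →
      A.indicator (𝓕 f : L2R) =ᵐ[volume] (𝓕 f : L2R) := fun f A h => by
    filter_upwards [h] with ξ hξ
    by_cases hmem : ξ ∈ A
    · rw [Set.indicator_of_mem hmem]
    · rw [Set.indicator_of_notMem hmem, hξ hmem]
  obtain ⟨φ, hφ, hφle, -, hφlim⟩ := exists_evol_approx f
    ((Lp.stronglyMeasurable (𝓕 f : L2R)).measurable.indicator hA) (key f hfA)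
  obtain ⟨χ, hχ, hχle, -, hχlim⟩ := exists_evol_approx h
    ((Lp.stronglyMeasurable (𝓕 h : L2R)).measurable.indicator hB) (key h hhB)
  have hmem : ∀ {A : Set ℝ} {F ψ : ℝ → ℂ} {ξ : ℝ}, ‖ψ ξ‖ ≤ ‖A.indicator F ξ‖ → ψ ξ ≠ 0 → ξ ∈ A :=
    fun {A F ψ ξ} h1 h2 => by
      by_contra h3
      rw [Set.indicator_of_notMem h3, norm_zero] at h1
      exact h2 (norm_le_zero_iff.1 h1)
  refine lintegral_lintegral_le_of_tendsto
    (w := fun k p => ‖evol (φ k) p.1 p.2‖ₑ ^ 2 * ‖evol (χ k) p.1 p.2‖ₑ ^ 2)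
    (fun k => ((measurable_evol (hφ k).meas).enorm.pow_const 2).mul
      ((measurable_evol (hχ k).meas).enorm.pow_const 2)) (fun k => ?_) fun r => ?_
  · refine (lintegral_evol_mul_evol_le (hφ k) (hχ k) hδ fun ξ η h1 h2 =>
      hsep ξ (hmem (hφle k ξ) h1) η (hmem (hχle k η) h2)).trans ?_
    gcongr
    · exact lintegral_enorm_sq_le_of_norm_le (key f hfA) (hφle k)
    · exact lintegral_enorm_sq_le_of_norm_le (key h hhB) (hχle k)
  · filter_upwards [hφlim r, hχlim r] with x hx hx2
    exact ENNReal.Tendsto.mul (((ENNReal.continuous_pow 2).tendsto _).comp hx.enorm)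
      (Or.inr (by finiteness)) (((ENNReal.continuous_pow 2).tendsto _).comp hx2.enorm)
      (Or.inr (by finiteness))

theorem lintegral_mul_mul_mul_le {a b c d : ℝ → ℝ≥0∞} (ha : Measurable a) (hb : Measurable b)
    (hc : Measurable c) (hd : Measurable d) :
    ∫⁻ x, a x * b x * c x * d x ≤ (∫⁻ x, a x ^ 2 * b x ^ 2) ^ (1 / 2 : ℝ) *
      (((∫⁻ x, c x ^ 2) ^ (1 / 8 : ℝ) * (∫⁻ x, c x ^ 6) ^ (1 / 8 : ℝ)) *
        ((∫⁻ x, d x ^ 2) ^ (1 / 8 : ℝ) * (∫⁻ x, d x ^ 6) ^ (1 / 8 : ℝ))) := by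
  have h := ENNReal.lintegral_prod_norm_pow_le (μ := (volume : Measure ℝ))
    (Finset.univ : Finset (Fin 5))
    (f := ![fun x => a x ^ 2 * b x ^ 2, fun x => c x ^ 2, fun x => c x ^ 6, fun x => d x ^ 2,
      fun x => d x ^ 6])
    (p := ![1 / 2, 1 / 8, 1 / 8, 1 / 8, 1 / 8])
    (fun i _ => by fin_cases i <;> exact Measurable.aemeasurable (by simp; fun_prop))
    (by simp [Fin.sum_univ_succ]; norm_num)
    (fun i _ => by fin_cases i <;> simp)
  have key : ∀ y : ℝ≥0∞, (y ^ 2) ^ (1 / 8 : ℝ) * (y ^ 6) ^ (1 / 8 : ℝ) = y := fun y => by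
    rw [← ENNReal.mul_rpow_of_nonneg _ _ (by norm_num), ← pow_add, ← ENNReal.rpow_natCast,
      ← ENNReal.rpow_mul]
    norm_num
  have key2 : ∀ y z : ℝ≥0∞, (y ^ 2 * z ^ 2) ^ (1 / 2 : ℝ) = y * z := fun y z => by
    rw [← mul_pow, ← ENNReal.rpow_natCast, ← ENNReal.rpow_mul]
    norm_num
  simp only [Fin.prod_univ_succ, Fin.prod_univ_zero, Matrix.cons_val_zero, Matrix.cons_val_succ,
    mul_one] at h
  refine (lintegral_congr fun x => ?_).trans_le (h.trans_eq (by ring))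
  rw [key2, ← mul_assoc (_ ^ (1 / 8 : ℝ)) (_ ^ (1 / 8 : ℝ)), key, key]
  ring

/-- Hölder's inequality in space and time, reducing a quadrilinear integral to a bilinear estimate
and to `L⁶` estimates. -/
theorem lintegral_lintegral_mul_le {a b c d : ℝ × ℝ → ℝ≥0∞} {w : ℝ → ℝ≥0∞} (ha : Measurable a)
    (hb : Measurable b) (hc : Measurable c) (hd : Measurable d) (hw : AEMeasurable w)
    {Nc Nd D : ℝ≥0∞} (hab : ∫⁻ r, ∫⁻ x, a (r, x) ^ 2 * b (r, x) ^ 2 ≤ D)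
    (hc2 : ∀ r, ∫⁻ x, c (r, x) ^ 2 ≤ Nc ^ 2) (hc6 : ∫⁻ r, ∫⁻ x, c (r, x) ^ 6 ≤ Nc ^ 6)
    (hd2 : ∀ r, ∫⁻ x, d (r, x) ^ 2 ≤ Nd ^ 2) (hd6 : ∫⁻ r, ∫⁻ x, d (r, x) ^ 6 ≤ Nd ^ 6) :
    ∫⁻ r, (∫⁻ x, a (r, x) * b (r, x) * c (r, x) * d (r, x)) * w r ≤
      (∫⁻ r, w r ^ 4) ^ (1 / 4 : ℝ) * D ^ (1 / 2 : ℝ) * Nc * Nd := by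
  have hmr : ∀ {e : ℝ × ℝ → ℝ≥0∞} (r : ℝ), Measurable e → Measurable fun x => e (r, x) :=
    fun r he => he.comp measurable_prodMk_left
  set B : ℝ → ℝ≥0∞ := fun r => ∫⁻ x, a (r, x) ^ 2 * b (r, x) ^ 2 with hB
  set C6 : ℝ → ℝ≥0∞ := fun r => ∫⁻ x, c (r, x) ^ 6 with hC6
  set D6 : ℝ → ℝ≥0∞ := fun r => ∫⁻ x, d (r, x) ^ 6 with hD6
  have hBm : Measurable B := ((ha.pow_const 2).mul (hb.pow_const 2)).lintegral_prod_right'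
  have hCm : Measurable C6 := (hc.pow_const 6).lintegral_prod_right'
  have hDm : Measurable D6 := (hd.pow_const 6).lintegral_prod_right'
  have hpt : ∀ r, (∫⁻ x, a (r, x) * b (r, x) * c (r, x) * d (r, x)) * w r ≤
      ((Nc ^ 2) ^ (1 / 8 : ℝ) * (Nd ^ 2) ^ (1 / 8 : ℝ)) * ((w r ^ 4) ^ (1 / 4 : ℝ) *
        (B r ^ (1 / 2 : ℝ) * (C6 r ^ (1 / 8 : ℝ) * D6 r ^ (1 / 8 : ℝ)))) := fun r => by
    have e1 : (w r ^ 4) ^ (1 / 4 : ℝ) = w r := by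
      rw [← ENNReal.rpow_natCast, ← ENNReal.rpow_mul]
      norm_num
    calc _ ≤ (B r ^ (1 / 2 : ℝ) * (((Nc ^ 2) ^ (1 / 8 : ℝ) * C6 r ^ (1 / 8 : ℝ)) *
          ((Nd ^ 2) ^ (1 / 8 : ℝ) * D6 r ^ (1 / 8 : ℝ)))) * w r := by
          gcongr
          refine (lintegral_mul_mul_mul_le (hmr r ha) (hmr r hb) (hmr r hc) (hmr r hd)).trans ?_
          gcongr
          · exact hc2 r
          · exact hd2 r
      _ = _ := by rw [e1]; ring
  have h := ENNReal.lintegral_prod_norm_pow_le (μ := (volume : Measure ℝ))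
    (Finset.univ : Finset (Fin 4))
    (f := ![fun r => w r ^ 4, B, C6, D6]) (p := ![1 / 4, 1 / 2, 1 / 8, 1 / 8])
    (fun i _ => by
      fin_cases i
      · exact hw.pow_const 4
      · exact hBm.aemeasurable
      · exact hCm.aemeasurable
      · exact hDm.aemeasurable)
    (by simp [Fin.sum_univ_succ]; norm_num)
    (fun i _ => by fin_cases i <;> simp)
  simp only [Fin.prod_univ_succ, Fin.prod_univ_zero, Matrix.cons_val_zero, Matrix.cons_val_succ,
    mul_one] at h
  have key : ∀ y : ℝ≥0∞, (y ^ 2) ^ (1 / 8 : ℝ) * (y ^ 6) ^ (1 / 8 : ℝ) = y := fun y => by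
    rw [← ENNReal.mul_rpow_of_nonneg _ _ (by norm_num), ← pow_add, ← ENNReal.rpow_natCast,
      ← ENNReal.rpow_mul]
    norm_num
  refine (lintegral_mono hpt).trans ?_
  rw [lintegral_const_mul'' _ (by fun_prop)]
  calc _ ≤ ((Nc ^ 2) ^ (1 / 8 : ℝ) * (Nd ^ 2) ^ (1 / 8 : ℝ)) *
        ((∫⁻ r, w r ^ 4) ^ (1 / 4 : ℝ) * (D ^ (1 / 2 : ℝ) *
          ((Nc ^ 6) ^ (1 / 8 : ℝ) * (Nd ^ 6) ^ (1 / 8 : ℝ)))) := by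
        refine mul_le_mul_right (h.trans ?_) _
        gcongr
    _ = (∫⁻ r, w r ^ 4) ^ (1 / 4 : ℝ) * D ^ (1 / 2 : ℝ) *
        ((Nc ^ 2) ^ (1 / 8 : ℝ) * (Nc ^ 6) ^ (1 / 8 : ℝ)) *
        ((Nd ^ 2) ^ (1 / 8 : ℝ) * (Nd ^ 6) ^ (1 / 8 : ℝ)) := by ring
    _ = _ := by rw [key, key]

theorem exists_perm_fin_four : ∀ i j : Fin 4, i ≠ j →
    ∃ σ : Equiv.Perm (Fin 4), σ 0 = i ∧ σ 1 = j := by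
  decide

theorem lintegral_quartic_le (f : Fin 4 → L2R) {i j : Fin 4} (hij : i ≠ j) {D : ℝ≥0∞}
    (hD : ∫⁻ r, ∫⁻ x, ‖freeEvolution r (f i) x‖ₑ ^ 2 * ‖freeEvolution r (f j) x‖ₑ ^ 2 ≤
      D * (‖f i‖ₑ ^ 2 * ‖f j‖ₑ ^ 2)) {w : ℝ → ℝ≥0∞} (hw : AEMeasurable w) :
    ∫⁻ r, (∫⁻ x, ∏ k, ‖freeEvolution r (f k) x‖ₑ) * w r ≤
      (∫⁻ r, w r ^ 4) ^ (1 / 4 : ℝ) * D ^ (1 / 2 : ℝ) * ∏ k, ‖f k‖ₑ := by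
  obtain ⟨σ, rfl, rfl⟩ := exists_perm_fin_four i j hij
  choose u hu hfu using fun k => exists_measurable_freeEvolution (f k)
  have hσ : ∀ F : Fin 4 → ℝ≥0∞, ∏ k, F k = F (σ 0) * F (σ 1) * F (σ 2) * F (σ 3) := fun F => by
    rw [← Equiv.prod_comp σ, Fin.prod_univ_four]
  have e1 : ∀ r, ∫⁻ x, ∏ k, ‖freeEvolution r (f k) x‖ₑ =
      ∫⁻ x, ‖u (σ 0) (r, x)‖ₑ * ‖u (σ 1) (r, x)‖ₑ * ‖u (σ 2) (r, x)‖ₑ * ‖u (σ 3) (r, x)‖ₑ :=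
    fun r => lintegral_congr_ae <| by
      filter_upwards [hfu (σ 0) r, hfu (σ 1) r, hfu (σ 2) r, hfu (σ 3) r] with x h0 h1 h2 h3
      rw [hσ, h0, h1, h2, h3]
  have e2 : ∀ k r, ∫⁻ x, ‖u k (r, x)‖ₑ ^ 2 ≤ ‖f k‖ₑ ^ 2 := fun k r => by
    rw [← enorm_freeEvolution r, ← lintegral_enorm_sq_eq]
    exact (lintegral_congr_ae (by filter_upwards [hfu k r] with x h; rw [h])).le
  have e3 : ∀ k, ∫⁻ r, ∫⁻ x, ‖u k (r, x)‖ₑ ^ 6 ≤ ‖f k‖ₑ ^ 6 := fun k => by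
    refine le_trans (le_of_eq (lintegral_congr fun r => lintegral_congr_ae ?_))
      (lintegral_freeEvolution_six_le (f k))
    filter_upwards [hfu k r] with x h
    rw [h]
  have e4 : ∫⁻ r, ∫⁻ x, ‖u (σ 0) (r, x)‖ₑ ^ 2 * ‖u (σ 1) (r, x)‖ₑ ^ 2 ≤
      D * (‖f (σ 0)‖ₑ ^ 2 * ‖f (σ 1)‖ₑ ^ 2) := by
    refine le_trans (le_of_eq (lintegral_congr fun r => lintegral_congr_ae ?_)) hD
    filter_upwards [hfu (σ 0) r, hfu (σ 1) r] with x h h'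
    rw [h, h']
  simp_rw [e1]
  refine (lintegral_lintegral_mul_le (hu (σ 0)).enorm (hu (σ 1)).enorm (hu (σ 2)).enorm
    (hu (σ 3)).enorm hw e4 (e2 _) (e3 _) (e2 _) (e3 _)).trans_eq ?_
  rw [ENNReal.mul_rpow_of_nonneg _ _ (by norm_num), hσ, ← mul_pow, ← ENNReal.rpow_natCast,
    ← ENNReal.rpow_mul]
  norm_num
  ring

theorem enorm_quarticIntegrand (f : Fin 4 → L2R) (r x : ℝ) :
    ‖quarticIntegrand f r x‖ₑ = ∏ k, ‖freeEvolution r (f k) x‖ₑ := by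
  simp only [quarticIntegrand, enorm_mul, RCLike.enorm_conj, Fin.prod_univ_four]

theorem ae_lintegral_prod_lt_top (f : Fin 4 → L2R) :
    ∀ᵐ r, ∫⁻ x, ∏ k, ‖freeEvolution r (f k) x‖ₑ < ∞ := by
  choose u hu hfu using fun k => exists_measurable_freeEvolution (f k)
  have e3 : ∀ k, ∫⁻ r, ∫⁻ x, ‖u k (r, x)‖ₑ ^ 6 ≤ ‖f k‖ₑ ^ 6 := fun k => by
    refine le_trans (le_of_eq (lintegral_congr fun r => lintegral_congr_ae ?_))
      (lintegral_freeEvolution_six_le (f k))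
    filter_upwards [hfu k r] with x h
    rw [h]
  have h1 : ∀ k, ∀ᵐ r, ∫⁻ x, ‖u k (r, x)‖ₑ ^ 6 < ∞ := fun k =>
    ae_lt_top (Measurable.lintegral_prod_right' ((hu k).enorm.pow_const 6))
      (ne_top_of_le_ne_top (by finiteness) (e3 k))
  filter_upwards [ae_all_iff.2 h1] with r hr
  have hle : ∀ y : Fin 4 → ℝ≥0∞, ∏ k, y k ≤ ∑ k, (y k ^ 2 + y k ^ 6) := fun y => by
    obtain ⟨m, -, hm⟩ := Finset.exists_max_image Finset.univ y ⟨0, Finset.mem_univ _⟩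
    calc ∏ k, y k ≤ ∏ _k : Fin 4, y m := Finset.prod_le_prod' fun k hk => hm k hk
      _ = y m ^ 4 := by simp
      _ ≤ y m ^ 2 + y m ^ 6 := by
          rcases le_total (y m) 1 with h | h
          · exact (pow_le_pow_of_le_one zero_le h (by norm_num)).trans le_self_add
          · exact (pow_le_pow_right₀ h (by norm_num)).trans le_add_self
      _ ≤ _ := Finset.single_le_sum (f := fun k => y k ^ 2 + y k ^ 6) (fun _ _ => zero_le)
          (Finset.mem_univ m)
  refine (lintegral_mono fun x => hle _).trans_lt ?_
  have hmeas : ∀ k, Measurable fun x => freeEvolution r (f k) x := fun k =>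
    (Lp.stronglyMeasurable (freeEvolution r (f k))).measurable
  rw [lintegral_finsetSum _ fun k _ => by have := hmeas k; fun_prop]
  refine ENNReal.sum_lt_top.2 fun k _ => ?_
  have := hmeas k
  rw [lintegral_add_left (by fun_prop), lintegral_enorm_sq_eq]
  refine ENNReal.add_lt_top.2 ⟨by finiteness, ?_⟩
  refine (lintegral_congr_ae ?_).trans_lt (hr k)
  filter_upwards [hfu k r] with x h
  rw [h]

theorem calQ_bound {ψ : ℝ → ℂ} (hψ : AEStronglyMeasurable ψ volume) (f : Fin 4 → L2R) {K : ℝ≥0∞}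
    (hK : K ≠ ∞) (h : ∫⁻ r, (∫⁻ x, ∏ k, ‖freeEvolution r (f k) x‖ₑ) * ‖ψ r‖ₑ ≤ K) :
    CalQConverges ψ f ∧ ‖calQ ψ f‖ ≤ K.toReal := by
  choose u hu hfu using fun k => exists_measurable_freeEvolution (f k)
  set q : ℝ × ℝ → ℂ := fun p => starRingEnd ℂ (u 0 p) * u 1 p * starRingEnd ℂ (u 2 p) * u 3 p
    with hq
  have hconj : Measurable fun z : ℂ => starRingEnd ℂ z := Complex.continuous_conj.measurable
  have hqm : Measurable q := (((hconj.comp (hu 0)).mul (hu 1)).mul (hconj.comp (hu 2))).mul (hu 3)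
  have hfq : ∀ r, quarticIntegrand f r =ᵐ[volume] fun x => q (r, x) := fun r => by
    filter_upwards [hfu 0 r, hfu 1 r, hfu 2 r, hfu 3 r] with x h0 h1 h2 h3
    simp only [quarticIntegrand, hq, h0, h1, h2, h3]
  have hqr : ∀ r, AEStronglyMeasurable (quarticIntegrand f r) volume := fun r =>
    (hqm.comp measurable_prodMk_left).aestronglyMeasurable.congr (hfq r).symm
  have hI : StronglyMeasurable fun r => ∫ x, quarticIntegrand f r x := by
    simp_rw [fun r => integral_congr_ae (hfq r)]
    exact hqm.stronglyMeasurable.integral_prod_right'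
  have hIn : StronglyMeasurable fun r => ∫ x, ‖quarticIntegrand f r x‖ := by
    have e : (fun r => ∫ x, ‖quarticIntegrand f r x‖) = fun r => ∫ x, ‖q (r, x)‖ := funext fun r =>
      integral_congr_ae (by filter_upwards [hfq r] with x hx; rw [hx])
    rw [e]
    exact hqm.norm.stronglyMeasurable.integral_prod_right'
  have hle : ∀ r, ‖(∫ x, quarticIntegrand f r x) * ψ r‖ₑ ≤
      (∫⁻ x, ∏ k, ‖freeEvolution r (f k) x‖ₑ) * ‖ψ r‖ₑ := fun r => by
    rw [enorm_mul]
    gcongr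
    refine (enorm_integral_le_lintegral_enorm _).trans_eq (lintegral_congr fun x => ?_)
    exact enorm_quarticIntegrand f r x
  have hlen : ∀ r, ‖(∫ x, ‖quarticIntegrand f r x‖) * ‖ψ r‖‖ₑ ≤
      (∫⁻ x, ∏ k, ‖freeEvolution r (f k) x‖ₑ) * ‖ψ r‖ₑ := fun r => by
    rw [enorm_mul, enorm_norm]
    gcongr
    refine (enorm_integral_le_lintegral_enorm _).trans_eq (lintegral_congr fun x => ?_)
    rw [enorm_norm, enorm_quarticIntegrand]
  refine ⟨⟨?_, ?_, ?_⟩, ?_⟩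
  · filter_upwards [ae_lintegral_prod_lt_top f] with r hr
    refine ⟨hqr r, ?_⟩
    rw [HasFiniteIntegral]
    simp_rw [enorm_quarticIntegrand]
    exact hr
  · exact ⟨hI.aestronglyMeasurable.mul hψ,
      ((lintegral_mono hle).trans h).trans_lt hK.lt_top⟩
  · exact ⟨hIn.aestronglyMeasurable.mul hψ.norm,
      ((lintegral_mono hlen).trans h).trans_lt hK.lt_top⟩
  · rw [← toReal_enorm]
    exact ENNReal.toReal_mono hK
      ((enorm_integral_le_lintegral_enorm _).trans ((lintegral_mono hle).trans h))

theorem ae_mem_essSupport {g : ℝ → ℂ} (hg : Measurable g) : ∀ᵐ x, x ∉ essSupport g → g x = 0 := by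
  have hS : MeasurableSet {y | g y ≠ 0} := (hg (measurableSet_singleton 0)).compl
  have h1 : (volume.restrict {y | g y ≠ 0}) (essSupport g)ᶜ = 0 := by
    refine measure_null_of_locally_null _ fun x hx => ?_
    simp only [essSupport, Set.mem_compl_iff, Set.mem_ofPred_eq, not_forall, not_not] at hx
    obtain ⟨U, hU, h⟩ := hx
    obtain ⟨V, hVU, hV, hxV⟩ := mem_nhds_iff.1 hU
    refine ⟨V, mem_nhdsWithin_of_mem_nhds (hV.mem_nhds hxV), ?_⟩
    have h2 := ae_restrict_of_ae_restrict_of_subset hVU h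
    rw [ae_restrict_iff' hV.measurableSet, ae_iff] at h2
    rw [Measure.restrict_apply hV.measurableSet]
    refine measure_mono_null ?_ h2
    rintro y ⟨hy1, hy2⟩
    simpa using ⟨hy1, hy2⟩
  rw [Measure.restrict_apply' hS] at h1
  rw [ae_iff]
  refine measure_mono_null ?_ h1
  intro y hy
  simpa using hy

theorem isClosed_essSupport (g : ℝ → ℂ) : IsClosed (essSupport g) := by
  rw [← isOpen_compl_iff, isOpen_iff_mem_nhds]
  intro x hx
  simp only [essSupport, Set.mem_compl_iff, Set.mem_ofPred_eq, not_forall, not_not] at hx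
  obtain ⟨U, hU, h⟩ := hx
  obtain ⟨V, hVU, hV, hxV⟩ := mem_nhds_iff.1 hU
  filter_upwards [hV.mem_nhds hxV] with y hy hmem
  exact hmem V (hV.mem_nhds hy) (ae_restrict_of_ae_restrict_of_subset hVU h)

theorem le_abs_sub_of_le_setDist {A B : Set ℝ} {s : ℝ} (h : ENNReal.ofReal s ≤ setDist A B)
    {x y : ℝ} (hx : x ∈ A) (hy : y ∈ B) : s ≤ |x - y| := by
  have h1 : setDist A B ≤ edist x y := (iInf₂_le x hx).trans (iInf₂_le y hy)
  have h2 := h.trans h1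
  rw [edist_dist, Real.dist_eq] at h2
  exact (ENNReal.ofReal_le_ofReal_iff (abs_nonneg _)).1 h2

/-- The quadrilinear estimate when two of the functions have frequencies separated by `δ`. -/
theorem lintegral_quartic_le_of_separated {ψ : ℝ → ℂ} (hψ : MemLp ψ 4 volume) (f : Fin 4 → L2R) {i j : Fin 4}
    (hij : i ≠ j) {A B : Set ℝ} (hA : MeasurableSet A) (hB : MeasurableSet B)
    (hfA : ∀ᵐ ξ, ξ ∉ A → (𝓕 (f i) : L2R) ξ = 0) (hfB : ∀ᵐ ξ, ξ ∉ B → (𝓕 (f j) : L2R) ξ = 0)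
    {δ : ℝ} (hδ : 0 < δ) (hsep : ∀ ξ ∈ A, ∀ η ∈ B, δ ≤ |ξ - η|) :
    ∫⁻ r, (∫⁻ x, ∏ k, ‖freeEvolution r (f k) x‖ₑ) * ‖ψ r‖ₑ ≤
      eLpNorm ψ 4 volume * ENNReal.ofReal (1 / √δ) * ∏ k, ‖f k‖ₑ := by
  refine (lintegral_quartic_le f hij (lintegral_freeEvolution_mul_le _ _ hA hB hfA hfB hδ hsep)
    hψ.1.enorm).trans_eq ?_
  congr 2
  · rw [eLpNorm_eq_lintegral_rpow_enorm_toReal (by norm_num) (by norm_num)]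
    norm_num
  · rw [ENNReal.ofReal_rpow_of_nonneg (by positivity) (by norm_num), ← Real.sqrt_eq_rpow,
      Real.sqrt_div zero_le_one, Real.sqrt_one]

theorem measurable_unitaryFourier (f : L2R) : Measurable (unitaryFourier f) := by
  have := (Lp.stronglyMeasurable (𝓕 f : L2R)).measurable
  unfold unitaryFourier
  fun_prop

/-- The frequency support in the variable of Mathlib's Fourier transform. -/
theorem ae_fourier_eq_zero (f : L2R) :
    ∀ᵐ ξ : ℝ, ξ ∉ (fun ξ => 2 * Real.pi * ξ) ⁻¹' essSupport (unitaryFourier f) →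
      (𝓕 f : L2R) ξ = 0 := by
  have h := ae_mem_essSupport (measurable_unitaryFourier f)
  have hpi : (2 * Real.pi) ≠ 0 := by positivity
  have hq : Measure.QuasiMeasurePreserving (fun ξ : ℝ => 2 * Real.pi * ξ) volume volume := by
    refine ⟨by fun_prop, ?_⟩
    rw [Real.map_volume_mul_left hpi]
    exact Measure.smul_absolutelyContinuous
  filter_upwards [hq.ae h] with ξ hξ hmem
  have h2 := hξ hmem
  have h3 : (√(2 * Real.pi))⁻¹ ≠ 0 := by positivity
  rw [unitaryFourier, mul_div_cancel_left₀ _ hpi, mul_eq_zero] at h2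
  exact h2.resolve_left (by exact_mod_cast h3)

theorem exists_bound_of_fourier_separated :
    ∃ C : ℝ → ℝ, ∀ ψ : ℝ → ℂ, MemLp ψ 4 volume →
      ∀ (f : Fin 4 → L2R) (i j : Fin 4), i ≠ j → ∀ s : ℝ, 0 < s →
        ENNReal.ofReal s ≤ setDist (essSupport (unitaryFourier (f i)))
          (essSupport (unitaryFourier (f j))) →
        CalQConverges ψ f ∧
          ‖calQ ψ f‖ ≤ C (eLpNorm ψ 4 volume).toReal * (1 / √s) * ∏ k, ‖f k‖ := by
  refine ⟨fun y => y * √(2 * Real.pi), fun ψ hψ f i j hij s hs hdist => ?_⟩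
  have hδ : 0 < s / (2 * Real.pi) := by positivity
  have hm : ∀ f : L2R,
      MeasurableSet ((fun ξ => 2 * Real.pi * ξ) ⁻¹' essSupport (unitaryFourier f)) := fun f =>
    (isClosed_essSupport _).measurableSet.preimage (by fun_prop)
  have h := lintegral_quartic_le_of_separated hψ f hij (hm _) (hm _) (ae_fourier_eq_zero (f i))
    (ae_fourier_eq_zero (f j)) hδ (fun ξ hξ η hη => by
      have h1 := le_abs_sub_of_le_setDist hdist hξ hη
      rw [← mul_sub, abs_mul, abs_of_pos (by positivity : 0 < 2 * Real.pi)] at h1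
      rw [div_le_iff₀ (by positivity)]
      linarith)
  have hfin : eLpNorm ψ 4 volume * ENNReal.ofReal (1 / √(s / (2 * Real.pi))) * ∏ k, ‖f k‖ₑ ≠ ∞ :=
    ENNReal.mul_ne_top (ENNReal.mul_ne_top hψ.2.ne ENNReal.ofReal_ne_top)
      (ENNReal.prod_ne_top fun _ _ => by finiteness)
  refine (calQ_bound hψ.1 f hfin h).imp_right fun h2 => h2.trans_eq ?_
  rw [ENNReal.toReal_mul, ENNReal.toReal_mul, ENNReal.toReal_ofReal (by positivity),
    ENNReal.toReal_prod, Real.sqrt_div hs.le]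
  simp only [toReal_enorm]
  rw [one_div_div]
  ring

section

variable {g : ℝ → ℂ}

theorem continuous_fourier_of_integrable (hg : Integrable g) : Continuous (𝓕 g) :=
  VectorFourier.fourierIntegral_continuous Real.continuous_fourierChar
    (by exact continuous_inner) hg

theorem norm_fourier_le (g : ℝ → ℂ) (ξ : ℝ) : ‖𝓕 g ξ‖ ≤ ∫ x, ‖g x‖ :=
  VectorFourier.norm_fourierIntegral_le_integral_norm _ _ _ _ _

theorem BddInt.memLp_fourier (hg : BddInt g) : MemLp (𝓕 g) 2 volume :=
  (memLp_congr_ae (fourier_toLp_ae_eq hg.int hg.memLp_two)).1 (Lp.memLp _)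

/-- The kernel of the Gaussian Fourier multiplier with complex width. -/
theorem fourierInv_gaussian_mul_fourier (hg : Integrable g) {b : ℂ} (hb : 0 < b.re) (x : ℝ) :
    𝓕⁻ (fun ξ : ℝ => Complex.exp (-b * ξ ^ 2) * 𝓕 g ξ) x =
      (Real.pi / b) ^ (1 / 2 : ℂ) *
        ∫ y : ℝ, Complex.exp (-(Real.pi ^ 2 * (x - y) ^ 2 / b)) * g y := by
  set h : ℝ → ℂ := fun ξ =>
    Complex.exp (↑(2 * Real.pi * (ξ * x)) * Complex.I) * Complex.exp (-b * ξ ^ 2) with hh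
  have hhi : Integrable h := (integrable_cexp_neg_mul_sq hb).bdd_mul (c := 1)
    (Continuous.aestronglyMeasurable (by fun_prop))
    (Filter.Eventually.of_forall fun ξ => (Complex.norm_exp_ofReal_mul_I _).le)
  have h1 : ∫ ξ, 𝓕 h ξ • g ξ = ∫ ξ, h ξ • 𝓕 g ξ := by
    have := VectorFourier.integral_fourierIntegral_smul_eq_flip (L := innerₗ ℝ) (μ := volume)
      (ν := volume) (e := 𝐞) Real.continuous_fourierChar (by exact continuous_inner)
      (f := h) (g := g) hhi hg
    simpa using! this
  have h2 : ∀ y : ℝ, 𝓕 h y =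
      (Real.pi / b) ^ (1 / 2 : ℂ) * Complex.exp (-(Real.pi ^ 2 * (x - y) ^ 2 / b)) := fun y => by
    have h3 := fourierIntegral_gaussian hb ((2 * Real.pi * (x - y) : ℝ) : ℂ)
    have h4 : -((2 * Real.pi * (x - y) : ℝ) : ℂ) ^ 2 / (4 * b) =
        -(Real.pi ^ 2 * (x - y) ^ 2 / b) := by
      have : b ≠ 0 := fun h0 => by simp [h0] at hb
      push_cast
      field_simp
      ring
    rw [h4] at h3
    rw [Real.fourier_real_eq_integral_exp_smul, ← h3]
    congr 1
    funext v
    rw [hh, smul_eq_mul, ← mul_assoc, ← Complex.exp_add]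
    congr 2
    push_cast
    ring
  rw [Real.fourierInv_eq', ← integral_const_mul]
  calc _ = ∫ ξ, h ξ • 𝓕 g ξ := by
        congr 1
        funext ξ
        simp only [hh, smul_eq_mul, RCLike.inner_apply, conj_trivial]
        rw [mul_comm x ξ]
        ring
    _ = _ := by
        rw [← h1]
        congr 1
        funext y
        rw [h2, smul_eq_mul, mul_assoc]

theorem norm_exp_neg_div_le_one {b : ℂ} (hb : 0 ≤ b.re) (u : ℝ) :
    ‖Complex.exp (-((u ^ 2 : ℝ) / b))‖ ≤ 1 := by
  rw [Complex.norm_exp, Real.exp_le_one_iff, Complex.neg_re, neg_nonpos, div_eq_mul_inv,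
    Complex.re_ofReal_mul, Complex.inv_re]
  have := Complex.normSq_nonneg b
  positivity

/-- The complex width `1 / (n + 1) + 4 π² i r` of the regularised symbol. -/
def width (r : ℝ) (n : ℕ) : ℂ :=
  ((1 / ((n : ℝ) + 1) : ℝ) : ℂ) + (4 * Real.pi ^ 2 * r : ℝ) * Complex.I

theorem width_re_pos (r : ℝ) (n : ℕ) : 0 < (width r n).re := by
  have : (0 : ℝ) < 1 / ((n : ℝ) + 1) := by positivity
  simpa only [width, Complex.add_re, Complex.ofReal_re, Complex.re_ofReal_mul, Complex.I_re,
    mul_zero, add_zero] using this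

theorem tendsto_width (r : ℝ) :
    Filter.Tendsto (width r) Filter.atTop (𝓝 ((4 * Real.pi ^ 2 * r : ℝ) * Complex.I)) := by
  have h := (Complex.continuous_ofReal.tendsto 0).comp
    (tendsto_one_div_add_atTop_nhds_zero_nat (𝕜 := ℝ))
  have h2 := h.add_const (((4 * Real.pi ^ 2 * r : ℝ) : ℂ) * Complex.I)
  rw [Complex.ofReal_zero, zero_add] at h2
  exact h2

theorem schrodingerSymbol_eq (r ξ : ℝ) :
    schrodingerSymbol r ξ = Complex.exp (-((4 * Real.pi ^ 2 * r : ℝ) * Complex.I) * ξ ^ 2) := by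
  unfold schrodingerSymbol
  congr 1
  push_cast
  ring

theorem norm_exp_neg_width_le_one (r : ℝ) (n : ℕ) (ξ : ℝ) :
    ‖Complex.exp (-width r n * ξ ^ 2)‖ ≤ 1 := by
  rw [Complex.norm_exp, Real.exp_le_one_iff, ← Complex.ofReal_pow, mul_comm,
    Complex.re_ofReal_mul, Complex.neg_re]
  nlinarith [width_re_pos r n, sq_nonneg ξ, mul_nonneg (sq_nonneg ξ) (width_re_pos r n).le]

theorem tendsto_lintegral_freeEvolution_sub (hg : BddInt g) (r : ℝ) :
    Filter.Tendsto (fun n => ∫⁻ x, ‖freeEvolution r (hg.memLp_two.toLp g) x -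
      𝓕⁻ (fun ξ : ℝ => Complex.exp (-width r n * ξ ^ 2) * 𝓕 g ξ) x‖ₑ ^ 2) Filter.atTop (𝓝 0) := by
  have hc := continuous_fourier_of_integrable hg.int
  have hcn : ∀ n, Continuous fun ξ : ℝ => Complex.exp (-width r n * ξ ^ 2) := fun n => by fun_prop
  have hF := hg.memLp_fourier
  have h1 : ∀ n, Integrable fun ξ : ℝ => Complex.exp (-width r n * ξ ^ 2) * 𝓕 g ξ := fun n =>
    (integrable_cexp_neg_mul_sq (width_re_pos r n)).mul_bdd (c := ∫ x, ‖g x‖)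
      hc.aestronglyMeasurable (Filter.Eventually.of_forall fun ξ => norm_fourier_le g ξ)
  have h2 : ∀ n, MemLp (fun ξ : ℝ => Complex.exp (-width r n * ξ ^ 2) * 𝓕 g ξ) 2 volume := fun n =>
    hF.of_le ((hcn n).mul hc).aestronglyMeasurable (Filter.Eventually.of_forall fun ξ => by
      rw [norm_mul]
      exact mul_le_of_le_one_left (norm_nonneg _) (norm_exp_neg_width_le_one r n ξ))
  have h3 : ∀ n, ∫⁻ x, ‖freeEvolution r (hg.memLp_two.toLp g) x -
      𝓕⁻ (fun ξ : ℝ => Complex.exp (-width r n * ξ ^ 2) * 𝓕 g ξ) x‖ₑ ^ 2 =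
      ∫⁻ ξ, ‖(schrodingerSymbol r ξ - Complex.exp (-width r n * ξ ^ 2)) * 𝓕 g ξ‖ₑ ^ 2 := fun n => by
    rw [lintegral_freeEvolution_sub_fourierInv (h1 n) (h2 n)]
    refine lintegral_congr_ae ?_
    filter_upwards [fourier_toLp_ae_eq hg.int hg.memLp_two] with ξ hξ
    rw [hξ, sub_mul]
  simp_rw [h3]
  have hfin : ∫⁻ ξ, ‖(2 : ℂ) * 𝓕 g ξ‖ₑ ^ 2 ≠ ∞ := by
    simp_rw [enorm_mul, mul_pow]
    rw [lintegral_const_mul' _ _ (by finiteness), hg.lintegral_fourier]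
    have h5 : ∫⁻ x, ‖g x‖ₑ ^ 2 = ‖hg.memLp_two.toLp g‖ₑ ^ 2 := by
      rw [← lintegral_enorm_sq_eq]
      refine lintegral_congr_ae ?_
      filter_upwards [hg.memLp_two.coeFn_toLp] with x hx
      rw [hx]
    rw [h5]
    finiteness
  have h := tendsto_lintegral_of_dominated_convergence (μ := volume)
    (F := fun n ξ => ‖(schrodingerSymbol r ξ - Complex.exp (-width r n * ξ ^ 2)) * 𝓕 g ξ‖ₑ ^ 2)
    (f := fun _ => 0) (fun ξ => ‖(2 : ℂ) * 𝓕 g ξ‖ₑ ^ 2)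
    (fun n => by
      have := (continuous_schrodingerSymbol r).sub (hcn n)
      exact ((this.mul hc).measurable.enorm).pow_const 2)
    (fun n => Filter.Eventually.of_forall fun ξ => by
      dsimp only
      gcongr
      refine enorm_le_iff_norm_le.2 ?_
      rw [norm_mul, norm_mul, Complex.norm_ofNat]
      gcongr
      refine (norm_sub_le _ _).trans ?_
      rw [norm_schrodingerSymbol]
      linarith [norm_exp_neg_width_le_one r n ξ]) hfin
    (Filter.Eventually.of_forall fun ξ => by
      have h4 : Filter.Tendsto (fun n => Complex.exp (-width r n * ξ ^ 2)) Filter.atTop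
          (𝓝 (schrodingerSymbol r ξ)) := by
        rw [schrodingerSymbol_eq]
        exact (Complex.continuous_exp.tendsto _).comp ((tendsto_width r).neg.mul_const _)
      have h5 := ((h4.const_sub (schrodingerSymbol r ξ)).mul_const (𝓕 g ξ)).enorm
      rw [sub_self, zero_mul, enorm_zero] at h5
      have h6 := ((ENNReal.continuous_pow 2).tendsto 0).comp h5
      rw [zero_pow two_ne_zero] at h6
      exact h6)
  simpa using h

theorem tendsto_fourierInv_width (hg : BddInt g) {r : ℝ} (hr : r ≠ 0) (x : ℝ) :
    Filter.Tendsto (fun n => 𝓕⁻ (fun ξ : ℝ => Complex.exp (-width r n * ξ ^ 2) * 𝓕 g ξ) x)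
      Filter.atTop (𝓝 ((Real.pi / ((4 * Real.pi ^ 2 * r : ℝ) * Complex.I)) ^ (1 / 2 : ℂ) *
        ∫ y : ℝ, Complex.exp (-(Real.pi ^ 2 * (x - y) ^ 2 / ((4 * Real.pi ^ 2 * r : ℝ) * Complex.I)))
          * g y)) := by
  have hne : ((4 * Real.pi ^ 2 * r : ℝ) : ℂ) * Complex.I ≠ 0 :=
    mul_ne_zero (Complex.ofReal_ne_zero.2 (by positivity)) Complex.I_ne_zero
  simp_rw [fun n => fourierInv_gaussian_mul_fourier hg.int (width_re_pos r n) x]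
  refine Filter.Tendsto.mul ?_ ?_
  · have h1 : Filter.Tendsto (fun n => (Real.pi : ℂ) / width r n) Filter.atTop
        (𝓝 (Real.pi / ((4 * Real.pi ^ 2 * r : ℝ) * Complex.I))) :=
      tendsto_const_nhds.div (tendsto_width r) hne
    refine h1.cpow tendsto_const_nhds (Or.inr ?_)
    have : (Real.pi : ℂ) / ((4 * Real.pi ^ 2 * r : ℝ) * Complex.I) =
        (-(Real.pi / (4 * Real.pi ^ 2 * r)) : ℝ) * Complex.I := by
      rw [div_mul_eq_div_div, Complex.div_I]
      push_cast
      ring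
    rw [this, Complex.im_ofReal_mul, Complex.I_im, mul_one]
    have := Real.pi_pos
    exact neg_ne_zero.2 (by positivity)
  · refine tendsto_integral_of_dominated_convergence (fun y => ‖g y‖) (fun n => ?_) hg.int.norm
      (fun n => Filter.Eventually.of_forall fun y => ?_) (Filter.Eventually.of_forall fun y => ?_)
    · exact (Continuous.aestronglyMeasurable (by fun_prop)).mul hg.meas.aestronglyMeasurable
    · rw [norm_mul]
      refine mul_le_of_le_one_left (norm_nonneg _) ?_
      have := norm_exp_neg_div_le_one (width_re_pos r n).le (Real.pi * (x - y))
      rw [mul_pow] at this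
      push_cast at this
      exact this
    · refine Filter.Tendsto.mul_const _ ((Complex.continuous_exp.tendsto _).comp ?_)
      exact (tendsto_const_nhds.div (tendsto_width r) hne).neg

theorem enorm_kernel_eq {r : ℝ} (hr : r ≠ 0) (g : ℝ → ℂ) (x : ℝ) :
    ‖(Real.pi / ((4 * Real.pi ^ 2 * r : ℝ) * Complex.I)) ^ (1 / 2 : ℂ) *
        ∫ y : ℝ, Complex.exp (-(Real.pi ^ 2 * (x - y) ^ 2 / ((4 * Real.pi ^ 2 * r : ℝ) * Complex.I)))
          * g y‖ₑ =
      ENNReal.ofReal ((4 * Real.pi * |r|)⁻¹ ^ (1 / 2 : ℝ)) *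
        ‖evol g (-(1 / (16 * Real.pi ^ 2)) / r) (-(1 / (4 * Real.pi * r)) * x)‖ₑ := by
  have hpi := Real.pi_pos
  rw [enorm_mul]
  congr 1
  · rw [← ofReal_norm]
    congr 1
    have h : ((1 / 2 : ℂ)) = ((1 / 2 : ℝ) : ℂ) := by push_cast; rfl
    rw [h, Complex.norm_cpow_real, norm_div, norm_mul, Complex.norm_I, mul_one,
      Complex.norm_real, Complex.norm_real, Real.norm_eq_abs, Real.norm_eq_abs, abs_mul,
      abs_of_pos hpi, abs_of_pos (by positivity : 0 < 4 * Real.pi ^ 2)]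
    congr 1
    field_simp
  · unfold evol
    have e : ∀ y : ℝ,
        Complex.exp (-(Real.pi ^ 2 * (x - y) ^ 2 / ((4 * Real.pi ^ 2 * r : ℝ) * Complex.I))) * g y =
        Complex.exp ((x ^ 2 / (4 * r) : ℝ) * Complex.I) *
          (Complex.exp (↑(2 * Real.pi * (inner ℝ y (-(1 / (4 * Real.pi * r)) * x))) * Complex.I) •
            (schrodingerSymbol (-(1 / (16 * Real.pi ^ 2)) / r) y * g y)) := fun y => by
      rw [smul_eq_mul, ← mul_assoc, ← mul_assoc, schrodingerSymbol_eq, ← Complex.exp_add,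
        ← Complex.exp_add]
      congr 2
      have hr' : (r : ℂ) ≠ 0 := Complex.ofReal_ne_zero.2 hr
      have hpi' : (Real.pi : ℂ) ≠ 0 := Complex.ofReal_ne_zero.2 hpi.ne'
      have hI : (Complex.I : ℂ) ^ 2 = -1 := Complex.I_sq
      simp only [RCLike.inner_apply, conj_trivial]
      push_cast
      field_simp
      rw [hI]
      ring
    simp_rw [e]
    rw [integral_const_mul, enorm_mul, ← Real.fourierInv_eq', ← ofReal_norm (Complex.exp _),
      Complex.norm_exp_ofReal_mul_I, ENNReal.ofReal_one, one_mul]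

theorem enorm_freeEvolution_toLp_ae_eq (hg : BddInt g) {r : ℝ} (hr : r ≠ 0) :
    ∀ᵐ x, ‖freeEvolution r (hg.memLp_two.toLp g) x‖ₑ =
      ENNReal.ofReal ((4 * Real.pi * |r|)⁻¹ ^ (1 / 2 : ℝ)) *
        ‖evol g (-(1 / (16 * Real.pi ^ 2)) / r) (-(1 / (4 * Real.pi * r)) * x)‖ₑ := by
  set T := freeEvolution r (hg.memLp_two.toLp g) with hT
  have hTm := (Lp.stronglyMeasurable T).measurable
  set v : ℕ → ℝ → ℂ := fun n => 𝓕⁻ (fun ξ : ℝ => Complex.exp (-width r n * ξ ^ 2) * 𝓕 g ξ) with hv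
  set l : ℝ → ℂ := fun x => (Real.pi / ((4 * Real.pi ^ 2 * r : ℝ) * Complex.I)) ^ (1 / 2 : ℂ) *
        ∫ y : ℝ, Complex.exp (-(Real.pi ^ 2 * (x - y) ^ 2 / ((4 * Real.pi ^ 2 * r : ℝ) * Complex.I)))
          * g y with hl
  have hvl : ∀ x, Filter.Tendsto (fun n => v n x) Filter.atTop (𝓝 (l x)) :=
    fun x => tendsto_fourierInv_width hg hr x
  have hvm : ∀ n, Measurable (v n) := fun n => by
    have h1 : Integrable fun ξ : ℝ => Complex.exp (-width r n * ξ ^ 2) * 𝓕 g ξ :=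
      (integrable_cexp_neg_mul_sq (width_re_pos r n)).mul_bdd (c := ∫ x, ‖g x‖)
        (continuous_fourier_of_integrable hg.int).aestronglyMeasurable
        (Filter.Eventually.of_forall fun ξ => norm_fourier_le g ξ)
    have e : v n = fun x => 𝓕 (fun ξ : ℝ => Complex.exp (-width r n * ξ ^ 2) * 𝓕 g ξ) (-x) :=
      funext (fourierInv_eq_fourier_comp_neg_apply _)
    rw [e]
    exact ((continuous_fourier_of_integrable h1).comp continuous_neg).measurable
  have hlm : Measurable l := measurable_of_tendsto_metrizable hvm (tendsto_pi_nhds.2 hvl)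
  have hzero : ∫⁻ x, ‖T x - l x‖ₑ ^ 2 = 0 := by
    refine le_antisymm ?_ zero_le
    calc ∫⁻ x, ‖T x - l x‖ₑ ^ 2
        = ∫⁻ x, Filter.liminf (fun n => ‖T x - v n x‖ₑ ^ 2) Filter.atTop :=
          lintegral_congr fun x => (Filter.Tendsto.liminf_eq
            (((ENNReal.continuous_pow 2).tendsto _).comp ((hvl x).const_sub (T x)).enorm)).symm
      _ ≤ Filter.liminf (fun n => ∫⁻ x, ‖T x - v n x‖ₑ ^ 2) Filter.atTop :=
          lintegral_liminf_le fun n => (hTm.sub (hvm n)).enorm.pow_const 2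
      _ = 0 := (tendsto_lintegral_freeEvolution_sub hg r).liminf_eq
  have hsm : Measurable fun x => ‖T x - l x‖ₑ ^ 2 := (hTm.sub hlm).enorm.pow_const 2
  rw [lintegral_eq_zero_iff hsm] at hzero
  filter_upwards [hzero] with x hx
  have h1 : T x = l x := by simpa [sub_eq_zero] using hx
  rw [h1, hl]
  exact enorm_kernel_eq hr g x

theorem lintegral_freeEvolution_sub_freeEvolution (r : ℝ) (f h : L2R) :
    ∫⁻ x, ‖freeEvolution r f x - freeEvolution r h x‖ₑ ^ 2 = ∫⁻ x, ‖f x - h x‖ₑ ^ 2 := by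
  set A : L2R := (memLp_schrodingerSymbol_mul r (𝓕 f)).toLp _ with hA
  set B : L2R := (memLp_schrodingerSymbol_mul r (𝓕 h)).toLp _ with hB
  have hsub : (𝓕 f : L2R) - 𝓕 h = 𝓕 (f - h) := ((Lp.fourierTransformₗᵢ ℝ ℂ).map_sub f h).symm
  calc _ = ∫⁻ x, ‖(𝓕⁻ (A - B) : L2R) x‖ₑ ^ 2 := lintegral_congr_ae <| by
        filter_upwards [coeFn_fourierInv_sub A B] with x hx
        rw [hx]
        rfl
    _ = ∫⁻ ξ, ‖(A - B : L2R) ξ‖ₑ ^ 2 := by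
        rw [lintegral_enorm_sq_eq, lintegral_enorm_sq_eq, enorm_fourierInv_eq]
    _ = ∫⁻ ξ, ‖((𝓕 f : L2R) - 𝓕 h : L2R) ξ‖ₑ ^ 2 := lintegral_congr_ae <| by
        filter_upwards [Lp.coeFn_sub A B, Lp.coeFn_sub (𝓕 f : L2R) (𝓕 h),
          (memLp_schrodingerSymbol_mul r (𝓕 f)).coeFn_toLp,
          (memLp_schrodingerSymbol_mul r (𝓕 h)).coeFn_toLp] with ξ h1 h2 h3 h4
        rw [h1, h2, Pi.sub_apply, Pi.sub_apply, hA, hB, h3, h4, ← mul_sub, enorm_mul,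
          ← ofReal_norm (schrodingerSymbol r ξ), norm_schrodingerSymbol, ENNReal.ofReal_one,
          one_mul]
    _ = ∫⁻ x, ‖(f - h : L2R) x‖ₑ ^ 2 := by
        rw [hsub, lintegral_enorm_sq_eq, lintegral_enorm_sq_eq, enorm_fourier_eq]
    _ = _ := lintegral_congr_ae <| by
        filter_upwards [Lp.coeFn_sub f h] with x hx
        rw [hx, Pi.sub_apply]

/-- The evolution at time `r` is, up to a factor of modulus one and a dilation, the evolution at
time `-1 / (16 π² r)` of the inverse Fourier transform. -/
theorem enorm_freeEvolution_ae_eq (f : L2R) {r : ℝ} (hr : r ≠ 0) :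
    ∀ᵐ x, ‖freeEvolution r f x‖ₑ =
      ENNReal.ofReal ((4 * Real.pi * |r|)⁻¹ ^ (1 / 2 : ℝ)) *
        ‖freeEvolution (-(1 / (16 * Real.pi ^ 2)) / r) (𝓕⁻ f) (-(1 / (4 * Real.pi * r)) * x)‖ₑ := by
  have hpi := Real.pi_pos
  have hG : (f : ℝ → ℂ) =ᵐ[volume] (𝓕 (𝓕⁻ f : L2R) : L2R) := by
    rw [FourierTransform.fourier_fourierInv_eq]
  obtain ⟨φ, hφ, -, hsum, hlim⟩ := exists_evol_approx (𝓕⁻ f : L2R)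
    (Lp.stronglyMeasurable f).measurable hG
  have hq : Measure.QuasiMeasurePreserving (fun x : ℝ => -(1 / (4 * Real.pi * r)) * x)
      volume volume := by
    refine ⟨by fun_prop, ?_⟩
    rw [Real.map_volume_mul_left (neg_ne_zero.2 (by positivity))]
    exact Measure.smul_absolutelyContinuous
  have h1 := hq.ae (hlim (-(1 / (16 * Real.pi ^ 2)) / r))
  have h2 := ae_all_iff.2 fun k => enorm_freeEvolution_toLp_ae_eq (hφ k) hr
  have hm : ∀ k, AEMeasurable (fun x => ‖freeEvolution r f x -
      freeEvolution r ((hφ k).memLp_two.toLp (φ k)) x‖ₑ ^ 2) volume := fun k => by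
    have h3 := (Lp.stronglyMeasurable (freeEvolution r f)).measurable
    have h4 := (Lp.stronglyMeasurable
      (freeEvolution r ((hφ k).memLp_two.toLp (φ k)))).measurable
    exact ((h3.sub h4).enorm.pow_const 2).aemeasurable
  have h3 : ∫⁻ x, ∑' k, ‖freeEvolution r f x -
      freeEvolution r ((hφ k).memLp_two.toLp (φ k)) x‖ₑ ^ 2 ≠ ∞ := by
    rw [lintegral_tsum hm]
    refine ne_of_eq_of_ne (tsum_congr fun k => ?_) hsum
    rw [lintegral_freeEvolution_sub_freeEvolution]
    refine lintegral_congr_ae ?_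
    filter_upwards [(hφ k).memLp_two.coeFn_toLp] with x hx
    rw [hx]
  filter_upwards [h1, h2, ae_lt_top' (AEMeasurable.tsum hm) h3] with x hx1 hx2 hx3
  have h4 := (tendsto_of_tsum_enorm_sub_sq hx3.ne).enorm
  have h5 := ENNReal.Tendsto.const_mul
    (a := ENNReal.ofReal ((4 * Real.pi * |r|)⁻¹ ^ (1 / 2 : ℝ))) hx1.enorm
    (Or.inr ENNReal.ofReal_ne_top)
  simp_rw [hx2] at h4
  exact tendsto_nhds_unique h4 h5

end

theorem lintegral_comp_neg_div {κ : ℝ} (hκ : 0 < κ) (f : ℝ → ℝ≥0∞) :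
    ∫⁻ r, f r = ∫⁻ ρ, ENNReal.ofReal (κ / ρ ^ 2) * f (-κ / ρ) := by
  have himg : (fun ρ : ℝ => -κ / ρ) '' {0}ᶜ = {0}ᶜ := by
    ext y
    constructor
    · rintro ⟨x, hx, rfl⟩
      exact div_ne_zero (neg_ne_zero.2 hκ.ne') hx
    · intro hy
      have hy' : y ≠ 0 := hy
      exact ⟨-κ / y, div_ne_zero (neg_ne_zero.2 hκ.ne') hy', by field_simp⟩
  have h := lintegral_image_eq_lintegral_abs_deriv_mul (f := fun ρ : ℝ => -κ / ρ)
    (f' := fun ρ => κ / ρ ^ 2) (s := {0}ᶜ) (measurableSet_singleton 0).compl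
    (fun x hx => by
      have := ((hasDerivAt_inv (Set.mem_compl_singleton_iff.1 hx)).const_mul (-κ))
      refine HasDerivAt.hasDerivWithinAt ?_
      simpa [div_eq_mul_inv] using this)
    (fun x _ y _ hxy => by
      simpa [div_eq_mul_inv, hκ.ne'] using hxy) f
  rw [himg, restrict_compl_singleton] at h
  rw [h]
  refine lintegral_congr fun ρ => ?_
  rw [abs_of_nonneg (by positivity)]

theorem lintegral_prod_freeEvolution (f : Fin 4 → L2R) {r : ℝ} (hr : r ≠ 0) :
    ∫⁻ x, ∏ k, ‖freeEvolution r (f k) x‖ₑ = ENNReal.ofReal ((4 * Real.pi * |r|)⁻¹) *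
      ∫⁻ x, ∏ k, ‖freeEvolution (-(1 / (16 * Real.pi ^ 2)) / r) (𝓕⁻ (f k)) x‖ₑ := by
  have hpi := Real.pi_pos
  have hr' : 0 < |r| := abs_pos.2 hr
  set c : ℝ≥0∞ := ENNReal.ofReal ((4 * Real.pi * |r|)⁻¹ ^ (1 / 2 : ℝ)) with hc
  set H : ℝ → ℝ≥0∞ := fun x =>
    ∏ k, ‖freeEvolution (-(1 / (16 * Real.pi ^ 2)) / r) (𝓕⁻ (f k)) x‖ₑ with hH
  have h1 : ∫⁻ x, ∏ k, ‖freeEvolution r (f k) x‖ₑ =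
      ∫⁻ x, c ^ 4 * H (-(1 / (4 * Real.pi * r)) * x) := by
    refine lintegral_congr_ae ?_
    filter_upwards [ae_all_iff.2 fun k => enorm_freeEvolution_ae_eq (f k) hr] with x hx
    simp_rw [hx]
    rw [Finset.prod_mul_distrib, Finset.prod_const, Finset.card_univ, Fintype.card_fin]
  rw [h1, lintegral_const_mul' _ _ (by finiteness),
    lintegral_comp_mul_left (neg_ne_zero.2 (by positivity)) H, ← mul_assoc]
  congr 1
  rw [hc, ← ENNReal.ofReal_pow (by positivity), ← ENNReal.ofReal_mul (by positivity)]
  congr 1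
  rw [← Real.rpow_natCast, ← Real.rpow_mul (by positivity), abs_inv, abs_neg, abs_div, abs_one,
    abs_mul, abs_of_pos (by positivity : 0 < 4 * Real.pi)]
  norm_num
  field_simp

/-- The density after inverting the time variable. -/
def invDensity (ψ : ℝ → ℂ) (ρ : ℝ) : ℝ≥0∞ :=
  ENNReal.ofReal ((4 * Real.pi * |ρ|)⁻¹) * ‖ψ (-(1 / (16 * Real.pi ^ 2)) / ρ)‖ₑ

theorem measurable_invDensity {ψ : ℝ → ℂ} (hψ : Measurable ψ) : Measurable (invDensity ψ) := by
  unfold invDensity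
  fun_prop

theorem lintegral_quartic_eq (f : Fin 4 → L2R) (ψ : ℝ → ℂ) :
    ∫⁻ r, (∫⁻ x, ∏ k, ‖freeEvolution r (f k) x‖ₑ) * ‖ψ r‖ₑ =
      ∫⁻ ρ, (∫⁻ x, ∏ k, ‖freeEvolution ρ (𝓕⁻ (f k)) x‖ₑ) * invDensity ψ ρ := by
  have hpi := Real.pi_pos
  have hκ : 0 < 1 / (16 * Real.pi ^ 2) := by positivity
  rw [lintegral_comp_neg_div hκ]
  refine lintegral_congr_ae ?_
  filter_upwards [Measure.ae_ne volume (0 : ℝ)] with ρ hρ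
  have hρ' : 0 < |ρ| := abs_pos.2 hρ
  have hne : -(1 / (16 * Real.pi ^ 2)) / ρ ≠ 0 := div_ne_zero (neg_ne_zero.2 hκ.ne') hρ
  have hinv : -(1 / (16 * Real.pi ^ 2)) / (-(1 / (16 * Real.pi ^ 2)) / ρ) = ρ := by
    field_simp
  rw [lintegral_prod_freeEvolution f hne, hinv, invDensity, ← mul_assoc, ← mul_assoc,
    ← ENNReal.ofReal_mul (by positivity), ← mul_assoc, mul_comm (∫⁻ x, _) (ENNReal.ofReal _)]
  congr 3
  rw [abs_div, abs_neg, abs_of_pos hκ, ← sq_abs ρ]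
  field_simp

theorem lintegral_invDensity (ψ : ℝ → ℂ) :
    ∫⁻ ρ, invDensity ψ ρ ^ 4 =
      ENNReal.ofReal (16 * Real.pi ^ 2) * ∫⁻ t, ENNReal.ofReal (t ^ 2) * ‖ψ t‖ₑ ^ 4 := by
  have hpi := Real.pi_pos
  have hκ : 0 < 1 / (16 * Real.pi ^ 2) := by positivity
  rw [lintegral_comp_neg_div hκ, ← lintegral_const_mul' _ _ ENNReal.ofReal_ne_top]
  refine lintegral_congr_ae ?_
  filter_upwards [Measure.ae_ne volume (0 : ℝ)] with r hr
  have hr' : 0 < |r| := abs_pos.2 hr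
  have hinv : -(1 / (16 * Real.pi ^ 2)) / (-(1 / (16 * Real.pi ^ 2)) / r) = r := by
    field_simp
  rw [invDensity, hinv, mul_pow, ← mul_assoc, ← mul_assoc, ← ENNReal.ofReal_pow (by positivity),
    ← ENNReal.ofReal_mul (by positivity), ← ENNReal.ofReal_mul (by positivity)]
  congr 2
  rw [abs_div, abs_neg, abs_of_pos hκ, ← sq_abs r]
  field_simp
  norm_num

theorem aestronglyMeasurable_of_sqMeasure {ψ : ℝ → ℂ} (hψ : AEStronglyMeasurable ψ sqMeasure) :
    AEStronglyMeasurable ψ volume := by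
  refine hψ.mono_ac (withDensity_absolutelyContinuous' (by fun_prop) ?_)
  filter_upwards [Measure.ae_ne volume (0 : ℝ)] with t ht
  exact (ENNReal.ofReal_pos.2 (by positivity)).ne'

theorem eLpNorm_sqMeasure {ψ : ℝ → ℂ} (hψ : Measurable ψ) :
    eLpNorm ψ 4 sqMeasure = (∫⁻ t, ENNReal.ofReal (t ^ 2) * ‖ψ t‖ₑ ^ 4) ^ (1 / 4 : ℝ) := by
  rw [eLpNorm_eq_lintegral_rpow_enorm_toReal (by norm_num) (by norm_num), sqMeasure,
    lintegral_withDensity_eq_lintegral_mul _ (by fun_prop) (by fun_prop)]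
  norm_num

/-- The quadrilinear estimate when two of the functions have supports separated by `δ`. -/
theorem lintegral_quartic_le_of_separated_support {ψ : ℝ → ℂ} (hψ : AEStronglyMeasurable ψ sqMeasure)
    (f : Fin 4 → L2R) {i j : Fin 4} (hij : i ≠ j) {A B : Set ℝ} (hA : MeasurableSet A)
    (hB : MeasurableSet B) (hfA : ∀ᵐ x, x ∉ A → f i x = 0) (hfB : ∀ᵐ x, x ∉ B → f j x = 0)
    {δ : ℝ} (hδ : 0 < δ) (hsep : ∀ x ∈ A, ∀ y ∈ B, δ ≤ |x - y|) :
    ∫⁻ r, (∫⁻ x, ∏ k, ‖freeEvolution r (f k) x‖ₑ) * ‖ψ r‖ₑ ≤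
      ENNReal.ofReal (16 * Real.pi ^ 2) ^ (1 / 4 : ℝ) * eLpNorm ψ 4 sqMeasure *
        ENNReal.ofReal (1 / √δ) * ∏ k, ‖f k‖ₑ := by
  have hψv := aestronglyMeasurable_of_sqMeasure hψ
  have hmk := hψv.stronglyMeasurable_mk.measurable
  have hac : sqMeasure ≪ volume := withDensity_absolutelyContinuous _ _
  have e1 : ∫⁻ r, (∫⁻ x, ∏ k, ‖freeEvolution r (f k) x‖ₑ) * ‖ψ r‖ₑ =
      ∫⁻ r, (∫⁻ x, ∏ k, ‖freeEvolution r (f k) x‖ₑ) * ‖hψv.mk ψ r‖ₑ :=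
    lintegral_congr_ae (by filter_upwards [hψv.ae_eq_mk] with r hr; rw [hr])
  have e2 : eLpNorm ψ 4 sqMeasure = eLpNorm (hψv.mk ψ) 4 sqMeasure :=
    eLpNorm_congr_ae (hac.ae_le hψv.ae_eq_mk)
  have hbil := lintegral_freeEvolution_mul_le (𝓕⁻ (f i) : L2R) (𝓕⁻ (f j) : L2R) hA hB
    (by simpa only [FourierTransform.fourier_fourierInv_eq] using hfA)
    (by simpa only [FourierTransform.fourier_fourierInv_eq] using hfB) hδ hsep
  rw [e1, e2, lintegral_quartic_eq]
  refine (lintegral_quartic_le (fun k => (𝓕⁻ (f k) : L2R)) hij hbil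
    (measurable_invDensity hmk).aemeasurable).trans_eq ?_
  simp_rw [enorm_fourierInv_eq]
  rw [lintegral_invDensity, eLpNorm_sqMeasure hmk, ENNReal.mul_rpow_of_nonneg _ _ (by norm_num),
    ENNReal.ofReal_rpow_of_nonneg (by positivity : 0 ≤ 1 / δ) (by norm_num), ← Real.sqrt_eq_rpow,
    Real.sqrt_div zero_le_one, Real.sqrt_one]

theorem exists_bound_of_support_separated :
    ∃ C : ℝ → ℝ, ∀ ψ : ℝ → ℂ, MemLp ψ 4 sqMeasure →
      ∀ (f : Fin 4 → L2R) (i j : Fin 4), i ≠ j → ∀ s : ℝ, 0 < s →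
        ENNReal.ofReal s ≤ setDist (essSupport (f i)) (essSupport (f j)) →
        CalQConverges ψ f ∧
          ‖calQ ψ f‖ ≤ C (eLpNorm ψ 4 sqMeasure).toReal * (1 / √s) * ∏ k, ‖f k‖ := by
  refine ⟨fun y => (ENNReal.ofReal (16 * Real.pi ^ 2) ^ (1 / 4 : ℝ)).toReal * y,
    fun ψ hψ f i j hij s hs hdist => ?_⟩
  have hm := fun k => (Lp.stronglyMeasurable (f k)).measurable
  have h := lintegral_quartic_le_of_separated_support hψ.1 f hij (isClosed_essSupport _).measurableSet
    (isClosed_essSupport _).measurableSet (ae_mem_essSupport (hm i)) (ae_mem_essSupport (hm j)) hs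
    fun x hx y hy => le_abs_sub_of_le_setDist hdist hx hy
  have hfin : ENNReal.ofReal (16 * Real.pi ^ 2) ^ (1 / 4 : ℝ) * eLpNorm ψ 4 sqMeasure *
      ENNReal.ofReal (1 / √s) * ∏ k, ‖f k‖ₑ ≠ ∞ :=
    ENNReal.mul_ne_top (ENNReal.mul_ne_top (ENNReal.mul_ne_top
      (ENNReal.rpow_ne_top_of_nonneg (by norm_num) ENNReal.ofReal_ne_top) hψ.2.ne)
      ENNReal.ofReal_ne_top) (ENNReal.prod_ne_top fun _ _ => by finiteness)
  refine (calQ_bound (aestronglyMeasurable_of_sqMeasure hψ.1) f hfin h).imp_right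
    fun h2 => h2.trans_eq ?_
  rw [ENNReal.toReal_mul, ENNReal.toReal_mul, ENNReal.toReal_mul,
    ENNReal.toReal_ofReal (by positivity : 0 ≤ 1 / √s), ENNReal.toReal_prod]
  simp only [toReal_enorm]

end DispersionManagement

end

theorem mainTheorem9 :
    (∃ C : ℝ → ℝ, ∀ ψ : ℝ → ℂ, MemLp ψ 4 volume →
      ∀ (f : Fin 4 → DispersionManagement.L2R) (i j : Fin 4), i ≠ j →
      ∀ s : ℝ, 0 < s →
        ENNReal.ofReal s ≤ DispersionManagement.setDist
          (DispersionManagement.essSupport (DispersionManagement.unitaryFourier (f i)))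
          (DispersionManagement.essSupport (DispersionManagement.unitaryFourier (f j))) →
        DispersionManagement.CalQConverges ψ f ∧
          ‖DispersionManagement.calQ ψ f‖ ≤
            C (eLpNorm ψ 4 volume).toReal * (1 / Real.sqrt s) * ∏ k, ‖f k‖) ∧
    (∃ C : ℝ → ℝ, ∀ ψ : ℝ → ℂ, MemLp ψ 4 DispersionManagement.sqMeasure →
      ∀ (f : Fin 4 → DispersionManagement.L2R) (i j : Fin 4), i ≠ j →
      ∀ s : ℝ, 0 < s →
        ENNReal.ofReal s ≤ DispersionManagement.setDist
          (DispersionManagement.essSupport (f i)) (DispersionManagement.essSupport (f j)) →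
        DispersionManagement.CalQConverges ψ f ∧
          ‖DispersionManagement.calQ ψ f‖ ≤
            C (eLpNorm ψ 4 DispersionManagement.sqMeasure).toReal * (1 / Real.sqrt s) *
              ∏ k, ‖f k‖) :=
  ⟨DispersionManagement.exists_bound_of_fourier_separated,
    DispersionManagement.exists_bound_of_support_separated⟩
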